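/- Write $(\mathbb{C}^2,0)$ for a neighborhood of the origin in $\mathbb{C}^2$; a local biholomorphism $F:(\mathbb{C}^2,0)\to(\mathbb{C}^2,0)$ is a biholomorphic map between open neighborhoods of $0$ with $F(0)=0$, and two such maps are identified if they agree near $0$. Let $G$ be a nontrivial finite subgroup of $\mathrm{SU}(2)$, and let $F:(\mathbb{C}^2,0)\to(\mathbb{C}^2,0)$ be a local biholomorphism with Jacobian matrix $J:=F'(0)\in\mathrm{GL}_2(\mathbb{C})$. Suppose that $F$ is $G$-equivariant, i.e. for every $g\in G$ and every $z\in\mathbb{C}^2$ sufficiently close to $0$, the point $(F\circ g\circ F^{-1})(z)$ lies in the $G$-orbit of $z$. Then $J$ normalizes $G$, that is, $JgJ^{-1}\in G$ for every $g\in G$, and $J$ is diagonalizable unless $|G|=2$. Suppose moreover that (i) $J$ is diagonalizable if $|G|=2$ (so that $J$ is diagonalizable in any case), and (ii) the pair $(\alpha_1,\alpha_2)$ of eigenvalues of $J$, counted with multiplicity, is Diophantine: there are constants $K>0$ and $c>0$ such that $$|\alpha_j-\alpha_1^{n_1}\alpha_2^{n_2}|\ \ge\ K\,(n_1+n_2)^{-c}$$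 for $j=1,2$ and all integers $n_1,n_2\ge 0$ with $n_1+n_2\ge 2$. Then there exists a unique local biholomorphism $\Phi:(\mathbb{C}^2,0)\to(\mathbb{C}^2,0)$ such that $$\Phi\circ F\circ\Phi^{-1}=J\ \text{ near } 0,\qquad \Phi'(0)=I,$$ and $\Phi$ commutes with every element of $G$: for every $g\in G$, $\Phi\circ g=g\circ\Phi$ near $0$. -/

import Mathlib

open Filter Topology Matrix

/-- A local biholomorphism `(ℂ², 0) → (ℂ², 0)`: a homeomorphism from an open neighbourhood of `0`
onto an open neighbourhood of `0`, fixing `0`, holomorphic with holomorphic inverse (holomorphic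
in several variables: given locally by convergent power series). Only the topology and the complex
structure of `ℂ² = Fin 2 → ℂ` matter here, not the choice of a norm. -/
structure IsLocalBiholomorphism (F : OpenPartialHomeomorph (Fin 2 → ℂ) (Fin 2 → ℂ)) : Prop where
  zero_mem_source : (0 : Fin 2 → ℂ) ∈ F.source
  map_zero : F 0 = 0
  analytic : AnalyticOnNhd ℂ F F.source
  analytic_symm : AnalyticOnNhd ℂ F.symm F.target

/-- The Jacobian matrix `F'(0)`. -/
noncomputable def jacobianAtZero (F : (Fin 2 → ℂ) → (Fin 2 → ℂ)) : Matrix (Fin 2) (Fin 2) ℂ :=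
  LinearMap.toMatrix' (fderiv ℂ F 0 : (Fin 2 → ℂ) →ₗ[ℂ] (Fin 2 → ℂ))

/-- `F` is `G`-equivariant: for every `g ∈ G` and every `z` sufficiently close to `0`,
`(F ∘ g ∘ F⁻¹)(z)` lies in the `G`-orbit of `z`. -/
def IsGEquivariant (G : Subgroup (Matrix.specialUnitaryGroup (Fin 2) ℂ))
    (F : OpenPartialHomeomorph (Fin 2 → ℂ) (Fin 2 → ℂ)) : Prop :=
  ∀ g ∈ G, ∀ᶠ z in 𝓝 (0 : Fin 2 → ℂ), ∃ h ∈ G,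
    F ((g : Matrix (Fin 2) (Fin 2) ℂ) *ᵥ F.symm z) = (h : Matrix (Fin 2) (Fin 2) ℂ) *ᵥ z

/-- A matrix is diagonalizable (over `ℂ`) if it is similar to a diagonal matrix. -/
def IsDiagonalizableMatrix (A : Matrix (Fin 2) (Fin 2) ℂ) : Prop :=
  ∃ (P : GL (Fin 2) ℂ) (d : Fin 2 → ℂ),
    A = (P : Matrix (Fin 2) (Fin 2) ℂ) * Matrix.diagonal d *
      ((P⁻¹ : GL (Fin 2) ℂ) : Matrix (Fin 2) (Fin 2) ℂ)

/-- The Diophantine condition on a pair of multipliers: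
`|α_j - α₁ ^ n₁ * α₂ ^ n₂| ≥ K (n₁ + n₂) ^ (-c)` for `j = 1, 2` and all `n₁, n₂ ≥ 0` with
`n₁ + n₂ ≥ 2`. -/
def IsDiophantinePair (α₁ α₂ : ℂ) : Prop :=
  ∃ K c : ℝ, 0 < K ∧ 0 < c ∧ ∀ n₁ n₂ : ℕ, 2 ≤ n₁ + n₂ →
    K * ((n₁ : ℝ) + (n₂ : ℝ)) ^ (-c) ≤ ‖α₁ - α₁ ^ n₁ * α₂ ^ n₂‖ ∧
    K * ((n₁ : ℝ) + (n₂ : ℝ)) ^ (-c) ≤ ‖α₂ - α₁ ^ n₁ * α₂ ^ n₂‖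

/-- `Φ` linearizes `F` into its Jacobian matrix `J = F'(0)` and is normalized:
`Φ ∘ F ∘ Φ⁻¹ = J` near `0` and `Φ'(0) = I`. -/
def IsNormalizedLinearization (F Φ : OpenPartialHomeomorph (Fin 2 → ℂ) (Fin 2 → ℂ)) : Prop :=
  (∀ᶠ z in 𝓝 (0 : Fin 2 → ℂ), Φ (F (Φ.symm z)) = jacobianAtZero F *ᵥ z) ∧ jacobianAtZero Φ = 1

/-! Normalization. The germ `F ∘ g ∘ F⁻¹` moves each point within its `G`-orbit, so its derivative
`M` satisfies `M v ∈ G v` for all `v`. Hence `ℂ²` is a finite union of the subspaces `ker (M - h)`,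
and one of them is everything. If `J` were not diagonalizable, then `J = a + N` with `N ≠ 0`, `N² =
0`. Some power of `J` commutes with the finite group `G`, hence so does `N`, which forces every
element of `G` to be `±1`, so `|G| = 2`.

Linearization (Siegel). In eigencoordinates `p ∘ q = q ∘ D` is solved degree by degree, dividing by
`d ^ k - d j`. Unfolding the recursion bounds each coefficient by a geometrically growing majorant
times a product of inverse divisors along a tree (`norm_linearizationSeries_wordBasis_le`). Bruno's
count (`DivisorTree.countP_bound`) controls the product: two small divisors at `l ≤ k` have a
quotient that is again a small divisor, of degree `|k| - |l| + 1`, so by the Diophantine condition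
they cannot be close in degree.

Uniqueness and symmetry. A germ without linear part that commutes with a nonresonant linear map is
zero, so the normalized linearization is unique. Since `G` acts freely off the origin, a germ moving
points within orbits equals its derivative, whence `F ∘ g = τ g ∘ F` for a permutation `τ` of `G`.
The average of `g⁻¹ ∘ Φ ∘ g` is then also a normalized linearization. It equals `Φ` by uniqueness,
and it commutes with `G`. -/

/-! ### Divisor trees and Bruno's counting argument -/

/-- Total degree of an exponent vector. -/
def expDegree (k : Fin 2 → ℕ) : ℕ := ∑ i, k i

theorem expDegree_sum {m : ℕ} (k : Fin m → Fin 2 → ℕ) :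
    expDegree (∑ i, k i) = ∑ i, expDegree (k i) := by
  simp only [expDegree, Finset.sum_apply]
  exact Finset.sum_comm

theorem expDegree_mono {k l : Fin 2 → ℕ} (h : k ≤ l) : expDegree k ≤ expDegree l :=
  Finset.sum_le_sum fun i _ => h i

theorem eq_of_le_of_expDegree {k l : Fin 2 → ℕ} (h : k ≤ l) (hd : expDegree l ≤ expDegree k) :
    k = l := by
  have h0 := h 0
  have h1 := h 1
  simp only [expDegree, Fin.sum_univ_two] at hd
  have e0 : k 0 = l 0 := by change k 0 ≤ l 0 at h0; change k 1 ≤ l 1 at h1; omega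
  have e1 : k 1 = l 1 := by change k 1 ≤ l 1 at h1; omega
  ext i
  fin_cases i
  exacts [e0, e1]

/-- `DivisorTree b k S`: `S` is the multiset of the weights `b` at the inner nodes of a finite tree
whose leaves are unit exponent vectors, whose inner nodes have at least two children and carry the
sum of the exponent vectors of their children, and whose root carries `k`. -/
inductive DivisorTree (b : (Fin 2 → ℕ) → ℝ) : (Fin 2 → ℕ) → Multiset ℝ → Prop
  | leaf (i : Fin 2) : DivisorTree b (Pi.single i 1) 0
  | node (m : ℕ) (hm : 2 ≤ m) (k : Fin m → Fin 2 → ℕ) (S : Fin m → Multiset ℝ)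
      (h : ∀ i, DivisorTree b (k i) (S i)) :
      DivisorTree b (∑ i, k i) (b (∑ i, k i) ::ₘ ∑ i, S i)

namespace DivisorTree

variable {b : (Fin 2 → ℕ) → ℝ} {k : Fin 2 → ℕ} {S : Multiset ℝ}

theorem card_lt_expDegree (h : DivisorTree b k S) : S.card + 1 ≤ expDegree k := by
  induction h with
  | leaf i => simp [expDegree]
  | node m hm k S h ih =>
    rw [expDegree_sum, Multiset.card_cons, Multiset.card_sum]
    have := Finset.sum_le_sum fun i (_ : i ∈ Finset.univ) => ih i
    rw [Finset.sum_add_distrib] at this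
    simp at this
    omega

theorem expDegree_pos (h : DivisorTree b k S) : 1 ≤ expDegree k := by
  have := h.card_lt_expDegree
  omega

theorem two_le_expDegree_sum {m : ℕ} (hm : 2 ≤ m) {k : Fin m → Fin 2 → ℕ}
    (h : ∀ i, 1 ≤ expDegree (k i)) : 2 ≤ expDegree (∑ i, k i) := by
  rw [expDegree_sum]
  calc 2 ≤ ∑ _i : Fin m, 1 := by simpa using hm
    _ ≤ _ := Finset.sum_le_sum fun i _ => h i

/-- Bruno's counting argument: the number of weights above the threshold `T` in a tree. -/
theorem countP_bound {T : ℝ} {t : ℕ}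
    (hsmall : ∀ k, 2 ≤ expDegree k → expDegree k ≤ t → b k ≤ T)
    (hpair : ∀ k l, 2 ≤ expDegree l → l ≤ k → l ≠ k → expDegree k < expDegree l + t →
      b k ≤ T ∨ b l ≤ T)
    (h : DivisorTree b k S) :
    (expDegree k ≤ t → S.countP (T < ·) = 0) ∧
    (t < expDegree k → S.countP (T < ·) * t + t ≤ 2 * expDegree k) ∧
    (∀ k₀, k ≤ k₀ → k ≠ k₀ → t < expDegree k₀ → T < b k₀ →
      (S.countP (T < ·) + 1) * t + t ≤ 2 * expDegree k₀) := by
  -- The third clause makes the induction close: it allows for one more heavy weight, at a strictly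
  -- larger exponent `k₀`, such as that of the parent node.
  induction h with
  | leaf i =>
    have h1 : expDegree (Pi.single i 1) = 1 := by
      simp [expDegree]
    refine ⟨fun _ => by simp, fun h => by simp [h1] at h ⊢; omega, fun k₀ _ _ h _ => ?_⟩
    simp
    omega
  | node m hm k S h ih =>
    have hpos : ∀ i, 1 ≤ expDegree (k i) := fun i => (h i).expDegree_pos
    have hk2 := two_le_expDegree_sum hm hpos
    have hle : ∀ i, k i ≤ ∑ j, k j := fun i =>
      Finset.single_le_sum (f := k) (fun j _ _ => Nat.zero_le _) (Finset.mem_univ i)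
    have hlt : ∀ i, expDegree (k i) < expDegree (∑ j, k j) := by
      intro i
      obtain ⟨j, hj⟩ : ∃ j : Fin m, j ≠ i := by
        have : Nontrivial (Fin m) := Fin.nontrivial_iff_two_le.2 hm
        exact exists_ne i
      rw [expDegree_sum]
      exact Finset.single_lt_sum (f := fun j => expDegree (k j)) hj (Finset.mem_univ _)
        (Finset.mem_univ _) (hpos j) fun l _ _ => Nat.zero_le _
    have hcount : ∀ s : Finset (Fin m), (∑ i ∈ s, S i).countP (T < ·)
        = ∑ i ∈ s, (S i).countP (T < ·) := fun s =>
      map_sum (Multiset.countPAddMonoidHom (T < ·)) S s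
    -- Only children of degree above `t` contribute to the count. The cases are no such child,
    -- exactly one, or several.
    set B := Finset.univ.filter fun i => t < expDegree (k i) with hB
    have hsumB : (∑ i, S i).countP (T < ·) = ∑ i ∈ B, (S i).countP (T < ·) := by
      rw [hcount]
      symm
      apply Finset.sum_subset (Finset.subset_univ _)
      intro i _ hi
      exact (ih i).1 (by simpa [hB] using hi)
    have hBt : (∑ i, S i).countP (T < ·) * t + B.card * t ≤ 2 * expDegree (∑ i, k i) := by
      calc (∑ i, S i).countP (T < ·) * t + B.card * t
          = ∑ i ∈ B, ((S i).countP (T < ·) * t + t) := by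
            rw [hsumB, Finset.sum_add_distrib, Finset.sum_mul]; simp
        _ ≤ ∑ i ∈ B, 2 * expDegree (k i) :=
            Finset.sum_le_sum fun i hi => (ih i).2.1 (by simpa [hB] using hi)
        _ ≤ ∑ i, 2 * expDegree (k i) :=
            Finset.sum_le_sum_of_subset (Finset.subset_univ _)
        _ = _ := by rw [expDegree_sum, Finset.mul_sum]
    have hB1 : B.card = 1 → ∃ i, (∑ i, S i).countP (T < ·) = (S i).countP (T < ·) := by
      intro hc
      obtain ⟨i, hi⟩ := Finset.card_eq_one.1 hc
      exact ⟨i, by rw [hsumB, hi]; simp⟩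
    have hB0 : B.card = 0 → (∑ i, S i).countP (T < ·) = 0 := by
      intro hc
      rw [hsumB, Finset.card_eq_zero.1 hc]; simp
    set K := ∑ i, k i with hK
    set N := (∑ i, S i).countP (T < ·) with hN
    -- Each large child leaves a surplus `t`; with two of them, one surplus pays for a heavy root
    -- and the other is kept.
    have hB2 : 2 ≤ B.card → N * t + 2 * t ≤ 2 * expDegree K := fun hc => by nlinarith
    have hsmall' : expDegree K ≤ t → N = 0 := by
      intro hKt
      rw [hN, hcount]
      exact Finset.sum_eq_zero fun i _ => (ih i).1 ((hlt i).le.trans hKt)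
    have hsecond : t < expDegree K →
        (b K ::ₘ ∑ i, S i).countP (T < ·) * t + t ≤ 2 * expDegree K := by
      intro ht
      rcases (by omega : B.card = 0 ∨ B.card = 1 ∨ 2 ≤ B.card) with hc | hc | hc
      · by_cases hb : T < b K
        · rw [Multiset.countP_cons_of_pos _ hb, ← hN, hB0 hc]; omega
        · rw [Multiset.countP_cons_of_neg _ hb, ← hN, hB0 hc]; omega
      · obtain ⟨i, hi⟩ := hB1 hc
        by_cases hb : T < b K
        · rw [Multiset.countP_cons_of_pos _ hb, ← hN, hi]
          exact (ih i).2.2 K (hle i) (fun e => (hlt i).ne (by rw [e])) ht hb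
        · rw [Multiset.countP_cons_of_neg _ hb, ← hN]; rw [hc] at hBt; omega
      · have := hB2 hc
        by_cases hb : T < b K
        · rw [Multiset.countP_cons_of_pos _ hb, ← hN]; linarith
        · rw [Multiset.countP_cons_of_neg _ hb, ← hN]; omega
    have hfirst : expDegree K ≤ t → (b K ::ₘ ∑ i, S i).countP (T < ·) = 0 := by
      intro ht
      rw [Multiset.countP_cons_of_neg _ (not_lt.2 (hsmall K hk2 ht)), ← hN, hsmall' ht]
    refine ⟨hfirst, hsecond, fun k₀ hk₀ hne ht₀ hb₀ => ?_⟩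
    -- A degree gap of at least `t` pays for `k₀` outright. With a smaller gap, `hpair` makes the
    -- root light, and `k₀` is passed on to the only large child.
    by_cases hfar : expDegree K + t ≤ expDegree k₀
    · by_cases ht : t < expDegree K
      · have := hsecond ht
        linarith
      · rw [hfirst (not_lt.1 ht)]; omega
    · have hb : ¬ T < b K := by
        rcases hpair k₀ K hk2 hk₀ hne (not_le.1 hfar) with h' | h'
        · exact absurd hb₀ (not_lt.2 h')
        · exact not_lt.2 h'
      rw [Multiset.countP_cons_of_neg _ hb, ← hN]
      rcases (by omega : B.card = 0 ∨ B.card = 1 ∨ 2 ≤ B.card) with hc | hc | hc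
      · rw [hB0 hc]; omega
      · obtain ⟨i, hi⟩ := hB1 hc
        rw [hi]
        refine (ih i).2.2 k₀ ((hle i).trans hk₀) (fun e => ?_) ht₀ hb₀
        have h1 := hlt i
        have h2 := expDegree_mono hk₀
        rw [e] at h1
        omega
      · have := hB2 hc
        have := expDegree_mono hk₀
        linarith

theorem nonneg_of_mem (hb : ∀ k, 0 ≤ b k) (h : DivisorTree b k S) : ∀ x ∈ S, 0 ≤ x := by
  induction h with
  | leaf i => simp
  | node m hm k S h ih =>
    intro x hx
    rcases Multiset.mem_cons.1 hx with rfl | hx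
    · exact hb _
    · obtain ⟨i, _, hi⟩ := Multiset.mem_sum.1 hx
      exact ih i x hi

theorem le_of_mem {C : ℝ} {e : ℕ} (hC : 0 ≤ C)
    (hsize : ∀ k, 2 ≤ expDegree k → b k ≤ C * (expDegree k : ℝ) ^ e)
    (h : DivisorTree b k S) : ∀ x ∈ S, x ≤ C * (expDegree k : ℝ) ^ e := by
  induction h with
  | leaf i => simp
  | node m hm k S h ih =>
    intro x hx
    rcases Multiset.mem_cons.1 hx with rfl | hx
    · exact hsize _ (two_le_expDegree_sum hm fun i => (h i).expDegree_pos)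
    · obtain ⟨i, _, hi⟩ := Multiset.mem_sum.1 hx
      refine (ih i x hi).trans ?_
      have : expDegree (k i) ≤ expDegree (∑ j, k j) :=
        expDegree_mono (Finset.single_le_sum (f := k) (fun j _ _ => Nat.zero_le _) (Finset.mem_univ i))
      gcongr

end DivisorTree

/-- The sum counts the thresholds `C * (2 ^ s) ^ e` lying below `x`. They increase with `s`, so
those below `x` form an initial segment, and `x` is at most the next threshold. -/
theorem le_two_pow_sum_indicator {C x : ℝ} {e L : ℕ} (hC : 0 ≤ C) (hx : x ≤ C * (2 ^ L) ^ e) :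
    x ≤ C * (2 ^ e) ^ (∑ s ∈ Finset.range L, if C * (2 ^ s) ^ e < x then 1 else 0) := by
  induction L with
  | zero => simpa using hx
  | succ L ih =>
    by_cases h : x ≤ C * (2 ^ L) ^ e
    · refine (ih h).trans ?_
      rw [Finset.sum_range_succ]
      have : (1 : ℝ) ≤ 2 ^ e := one_le_pow₀ (by norm_num)
      exact mul_le_mul_of_nonneg_left (pow_le_pow_right₀ this (Nat.le_add_right _ _)) hC
    · have : ∑ s ∈ Finset.range (L + 1), (if C * (2 ^ s) ^ e < x then 1 else 0) = L + 1 := by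
        rw [Finset.sum_congr rfl (g := fun _ => 1)]
        · simp
        · intro s hs
          rw [if_pos]
          refine lt_of_le_of_lt ?_ (not_le.1 h)
          have : s ≤ L := by simpa [Nat.lt_succ_iff] using hs
          have : (2 : ℝ) ^ s ≤ 2 ^ L := pow_le_pow_right₀ (by norm_num) this
          gcongr
      rw [this]
      calc x ≤ _ := hx
        _ = _ := by rw [← pow_mul, ← pow_mul, mul_comm e]

theorem prod_le_two_pow_sum_countP {C : ℝ} {e L : ℕ} (hC : 0 ≤ C) (S : Multiset ℝ)
    (h0 : ∀ x ∈ S, 0 ≤ x) (hx : ∀ x ∈ S, x ≤ C * (2 ^ L) ^ e) :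
    S.prod ≤ C ^ S.card * (2 ^ e) ^ (∑ s ∈ Finset.range L, S.countP (C * (2 ^ s) ^ e < ·)) := by
  induction S using Multiset.induction with
  | empty => simp
  | cons x S ih =>
    have h1 := le_two_pow_sum_indicator hC (hx x (Multiset.mem_cons_self x S))
    have h2 := ih (fun y hy => h0 y (Multiset.mem_cons_of_mem hy))
      fun y hy => hx y (Multiset.mem_cons_of_mem hy)
    have h3 : 0 ≤ S.prod := Multiset.prod_nonneg fun y hy => h0 y (Multiset.mem_cons_of_mem hy)
    rw [Multiset.prod_cons, Multiset.card_cons]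
    calc x * S.prod ≤ _ := mul_le_mul h1 h2 h3 (by positivity)
      _ = _ := by
        simp only [Multiset.countP_cons, Finset.sum_add_distrib, pow_add]
        ring

/-- The product of the inverse small divisors in a tree grows at most geometrically. -/
theorem DivisorTree.prod_le {b : (Fin 2 → ℕ) → ℝ} {k : Fin 2 → ℕ} {S : Multiset ℝ}
    {C : ℝ} {e : ℕ} (hC : 1 ≤ C) (hb : ∀ k, 0 ≤ b k)
    (hsize : ∀ k, 2 ≤ expDegree k → b k ≤ C * (expDegree k : ℝ) ^ e)
    (hpair : ∀ k l, 2 ≤ expDegree l → l ≤ k → l ≠ k →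
      min (b k) (b l) ≤ C * ((expDegree k : ℝ) - expDegree l) ^ e)
    (h : DivisorTree b k S) : S.prod ≤ (C * (2 ^ e) ^ 4) ^ expDegree k := by
  have hC0 : (0 : ℝ) ≤ C := by linarith
  set n := expDegree k with hn
  -- So `n` dyadic scales suffice: every weight in the tree is at most `C * n ^ e`.
  have hn2 : n ≤ 2 ^ n := Nat.lt_two_pow_self.le
  have hcount : ∀ s : ℕ, S.countP (C * (2 ^ s) ^ e < ·) * 2 ^ s ≤ 2 * n := by
    intro s
    obtain ⟨h1, h2, -⟩ := h.countP_bound (T := C * (2 ^ s) ^ e) (t := 2 ^ s)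
      (fun k hk hks => (hsize k hk).trans (by
        have : (expDegree k : ℝ) ≤ 2 ^ s := by exact_mod_cast hks
        gcongr))
      (fun k l hl hlk hne hd => by
        have hle := expDegree_mono hlk
        have h3 := hpair k l hl hlk hne
        have h4 : (expDegree k : ℝ) - expDegree l ≤ 2 ^ s := by
          have : (expDegree k : ℝ) < expDegree l + 2 ^ s := by exact_mod_cast hd
          linarith
        have h5 : (0 : ℝ) ≤ (expDegree k : ℝ) - expDegree l := by
          have : (expDegree l : ℝ) ≤ expDegree k := by exact_mod_cast hle
          linarith
        rw [← min_le_iff]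
        exact h3.trans (by gcongr))
    by_cases hs : n ≤ 2 ^ s
    · rw [h1 hs]; simp
    · exact (Nat.le_add_right _ _).trans (h2 (not_le.1 hs))
  -- The counts `2 * n / 2 ^ s` sum to at most `4 * n`, which is the source of the fourth power in
  -- the bound.
  have hsum : ∑ s ∈ Finset.range n, S.countP (C * (2 ^ s) ^ e < ·) ≤ 4 * n := by
    have h1 : ∀ s, (S.countP (C * (2 ^ s) ^ e < ·) : ℝ) ≤ 2 * n * (1 / 2) ^ s := by
      intro s
      have : ((S.countP (C * (2 ^ s) ^ e < ·) : ℕ) : ℝ) * 2 ^ s ≤ 2 * n := by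
        exact_mod_cast hcount s
      rw [one_div, inv_pow, ← div_eq_mul_inv, le_div_iff₀ (by positivity)]
      exact this
    have h2 : ((∑ s ∈ Finset.range n, S.countP (C * (2 ^ s) ^ e < ·) : ℕ) : ℝ) ≤ 4 * n := by
      push_cast
      calc _ ≤ ∑ s ∈ Finset.range n, 2 * (n : ℝ) * (1 / 2) ^ s := Finset.sum_le_sum fun s _ => h1 s
        _ = 2 * n * ∑ s ∈ Finset.range n, (1 / 2 : ℝ) ^ s := by rw [Finset.mul_sum]
        _ ≤ 2 * n * 2 := by gcongr; exact sum_geometric_two_le n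
        _ = 4 * n := by ring
    exact_mod_cast h2
  calc S.prod ≤ C ^ S.card * (2 ^ e) ^ (∑ s ∈ Finset.range n, S.countP (C * (2 ^ s) ^ e < ·)) := by
        refine prod_le_two_pow_sum_countP hC0 S (h.nonneg_of_mem hb) fun x hx =>
          (h.le_of_mem hC0 hsize x hx).trans ?_
        have : (n : ℝ) ≤ 2 ^ n := by exact_mod_cast hn2
        gcongr
    _ ≤ C ^ n * (2 ^ e) ^ (4 * n) := by
        have h1 : (1 : ℝ) ≤ 2 ^ e := one_le_pow₀ (by norm_num)
        have := h.card_lt_expDegree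
        exact mul_le_mul (pow_le_pow_right₀ hC (by omega)) (pow_le_pow_right₀ h1 hsum)
          (by positivity) (by positivity)
    _ = _ := by rw [mul_pow, ← pow_mul (2 ^ e : ℝ)]


/-! ### Words in two letters and the formal linearizing series -/

/-- The multiplicity vector of a word in two letters. -/
def wordExponent {n : ℕ} (w : Fin n → Fin 2) : Fin 2 → ℕ := ∑ i, Pi.single (w i) 1

theorem expDegree_single (i : Fin 2) : expDegree (Pi.single i 1) = 1 := by simp [expDegree]

theorem expDegree_wordExponent {n : ℕ} (w : Fin n → Fin 2) : expDegree (wordExponent w) = n := by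
  simp [wordExponent, expDegree_sum, expDegree_single]

theorem prod_pow_wordExponent (d : Fin 2 → ℂ) {n : ℕ} (w : Fin n → Fin 2) :
    ∏ j, d j ^ wordExponent w j = ∏ i, d (w i) := by
  simp only [wordExponent, Finset.sum_apply, ← Finset.prod_pow_eq_pow_sum]
  rw [Finset.prod_comm]
  refine Finset.prod_congr rfl fun i _ => ?_
  rw [Finset.prod_eq_single (w i)]
  · simp
  · intro j _ hj
    simp [hj]
  · simp

theorem sum_wordExponent_embedding {n : ℕ} (c : Composition n) (w : Fin n → Fin 2) :
    ∑ i, wordExponent (w ∘ c.embedding i) = wordExponent w := by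
  simp only [wordExponent, Function.comp]
  rw [← Fintype.sum_sigma' (f := fun i (j : Fin (c.blocksFun i)) =>
    (Pi.single (w (c.embedding i j)) 1 : Fin 2 → ℕ))]
  exact Fintype.sum_equiv c.blocksFinEquiv _ _ fun x => rfl

/-- The tuple of standard basis vectors spelled by a word. -/
noncomputable def wordBasis {n : ℕ} (w : Fin n → Fin 2) : Fin n → (Fin 2 → ℂ) :=
  fun i => Pi.single (w i) 1

/-- The multilinear map with prescribed values on tuples of standard basis vectors. -/
noncomputable def multilinearOfWords {n : ℕ} (z : (Fin n → Fin 2) → (Fin 2 → ℂ)) :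
    ContinuousMultilinearMap ℂ (fun _ : Fin n => Fin 2 → ℂ) (Fin 2 → ℂ) :=
  ∑ w, ((ContinuousMultilinearMap.mkPiAlgebra ℂ (Fin n) ℂ).compContinuousLinearMap
    (fun i => ContinuousLinearMap.proj (w i))).smulRight (z w)

theorem multilinearOfWords_apply {n : ℕ} (z : (Fin n → Fin 2) → (Fin 2 → ℂ))
    (v : Fin n → (Fin 2 → ℂ)) : multilinearOfWords z v = ∑ w, (∏ i, v i (w i)) • z w := by
  simp [multilinearOfWords]

theorem multilinearOfWords_wordBasis {n : ℕ} (z : (Fin n → Fin 2) → (Fin 2 → ℂ))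
    (w : Fin n → Fin 2) : multilinearOfWords z (wordBasis w) = z w := by
  rw [multilinearOfWords_apply, Finset.sum_eq_single w]
  · simp [wordBasis]
  · intro u _ hu
    obtain ⟨i, hi⟩ := Function.ne_iff.1 hu
    rw [Finset.prod_eq_zero (Finset.mem_univ i), zero_smul]
    simp [wordBasis, hi]
  · simp

theorem ContinuousMultilinearMap.ext_wordBasis {n : ℕ}
    {f g : ContinuousMultilinearMap ℂ (fun _ : Fin n => Fin 2 → ℂ) (Fin 2 → ℂ)}
    (h : ∀ w : Fin n → Fin 2, f (wordBasis w) = g (wordBasis w)) : f = g := by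
  apply ContinuousMultilinearMap.toMultilinearMap_injective
  refine Module.Basis.ext_multilinear (fun _ => Pi.basisFun ℂ (Fin 2)) fun w => ?_
  simpa [wordBasis, Pi.basisFun_apply] using! h w

theorem ContinuousMultilinearMap.norm_le_of_wordBasis {n : ℕ}
    (f : ContinuousMultilinearMap ℂ (fun _ : Fin n => Fin 2 → ℂ) (Fin 2 → ℂ)) {M : ℝ} (hM : 0 ≤ M)
    (h : ∀ w : Fin n → Fin 2, ‖f (wordBasis w)‖ ≤ M) : ‖f‖ ≤ 2 ^ n * M := by
  have hf : f = multilinearOfWords fun w => f (wordBasis w) :=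
    ContinuousMultilinearMap.ext_wordBasis fun w => by rw [multilinearOfWords_wordBasis]
  refine ContinuousMultilinearMap.opNorm_le_bound (by positivity) fun v => ?_
  rw [hf, multilinearOfWords_apply]
  calc ‖∑ w : Fin n → Fin 2, (∏ i, v i (w i)) • f (wordBasis w)‖
      ≤ ∑ w : Fin n → Fin 2, (∏ i, ‖v i‖) * M := by
        refine norm_sum_le_of_le _ fun w _ => ?_
        rw [norm_smul, norm_prod]
        exact mul_le_mul (Finset.prod_le_prod (fun _ _ => norm_nonneg _)
          fun i _ => norm_le_pi_norm (v i) (w i)) (h w) (norm_nonneg _)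
          (Finset.prod_nonneg fun _ _ => norm_nonneg _)
    _ = _ := by simp; ring

/-- The composition of length one contributes `p 1 (q' n)`, which vanishes; all others have blocks
shorter than `n`. The truncation used in the recursion can thus be replaced by the full series. -/
theorem comp_apply_of_eq_below {n : ℕ} (hn : 0 < n)
    (p : FormalMultilinearSeries ℂ (Fin 2 → ℂ) (Fin 2 → ℂ))
    {q q' : FormalMultilinearSeries ℂ (Fin 2 → ℂ) (Fin 2 → ℂ)} (h : ∀ k < n, q' k = q k)
    (h0 : q' n = 0) (v : Fin n → (Fin 2 → ℂ)) :
    p.comp q' n v = ∑ c ∈ {c : Composition n | 1 < c.length}.toFinset,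
      p c.length (q.applyComposition c v) := by
  rw [FormalMultilinearSeries.comp_rightInv_aux1 hn, h0]
  have : (p 1 fun _ => (0 : ContinuousMultilinearMap ℂ (fun _ : Fin n => Fin 2 → ℂ)
      (Fin 2 → ℂ)) v) = 0 := (p 1).map_coord_zero 0 rfl
  rw [this, add_zero]
  refine Finset.sum_congr rfl fun c hc => ?_
  congr 1
  ext1 i
  have hc' : 1 < c.length := by simpa using hc
  have hi : c.blocksFun i < n :=
    (Composition.ne_single_iff hn).1 (by rw [Ne, Composition.eq_single_iff_length]; omega) i
  simp only [FormalMultilinearSeries.applyComposition, h _ hi]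

/-- The formal solution `q = id + …` of `p ∘ q = q ∘ D`, where `D` is the diagonal map with entries
`d` and `p = D + …`. -/
noncomputable def linearizationSeries (d : Fin 2 → ℂ)
    (p : FormalMultilinearSeries ℂ (Fin 2 → ℂ) (Fin 2 → ℂ)) :
    FormalMultilinearSeries ℂ (Fin 2 → ℂ) (Fin 2 → ℂ)
  | 0 => 0
  | 1 => (continuousMultilinearCurryFin1 ℂ (Fin 2 → ℂ) (Fin 2 → ℂ)).symm
      (ContinuousLinearMap.id ℂ (Fin 2 → ℂ))
  | n + 2 =>
    -- Cutting off at degree `n + 2` makes the recursion well founded. The omitted linear term `d j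
    -- * q j` is accounted for by the `- d j` in the divisor.
    let q : FormalMultilinearSeries ℂ (Fin 2 → ℂ) (Fin 2 → ℂ) :=
      fun k => if k < n + 2 then linearizationSeries d p k else 0
    multilinearOfWords fun w j => p.comp q (n + 2) (wordBasis w) j / (∏ i, d (w i) - d j)

section LinearizationSeries

variable (d : Fin 2 → ℂ) (p : FormalMultilinearSeries ℂ (Fin 2 → ℂ) (Fin 2 → ℂ))

theorem linearizationSeries_zero : linearizationSeries d p 0 = 0 := by rw [linearizationSeries]

theorem linearizationSeries_one : linearizationSeries d p 1 =
    (continuousMultilinearCurryFin1 ℂ (Fin 2 → ℂ) (Fin 2 → ℂ)).symm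
      (ContinuousLinearMap.id ℂ (Fin 2 → ℂ)) := by rw [linearizationSeries]

theorem linearizationSeries_wordBasis {n : ℕ} (hn : 2 ≤ n) (w : Fin n → Fin 2) (j : Fin 2) :
    linearizationSeries d p n (wordBasis w) j =
      (∑ c ∈ {c : Composition n | 1 < c.length}.toFinset,
        p c.length ((linearizationSeries d p).applyComposition c (wordBasis w))) j /
        (∏ i, d (w i) - d j) := by
  obtain ⟨n, rfl⟩ := Nat.exists_eq_add_of_le' hn
  rw [linearizationSeries, multilinearOfWords_wordBasis]
  congr 2
  refine congrFun (comp_apply_of_eq_below (q := linearizationSeries d p) (Nat.succ_pos (n + 1)) p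
    (fun k hk => ?_) ?_ _) j
  · exact if_pos hk
  · exact if_neg (lt_irrefl (n + 2))

/-- On a basis word `w`, `D` acts through the scalar `∏ i, d (w i)`. In degree at least two the
equation becomes (terms of lower degree) `+ d j * q j = (∏ i, d (w i)) * q j`, which the recursion
solves because the divisor is nonzero. -/
theorem comp_linearizationSeries {D : (Fin 2 → ℂ) →L[ℂ] (Fin 2 → ℂ)}
    (hD : ∀ v j, D v j = d j * v j)
    (hd : ∀ k : Fin 2 → ℕ, 2 ≤ expDegree k → ∀ j, ∏ i, d i ^ k i ≠ d j)
    (hp0 : p 0 = 0)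
    (hp1 : p 1 = (continuousMultilinearCurryFin1 ℂ (Fin 2 → ℂ) (Fin 2 → ℂ)).symm D) :
    p.comp (linearizationSeries d p) = (linearizationSeries d p).compContinuousLinearMap D := by
  have hDw : ∀ {n : ℕ} (w : Fin n → Fin 2),
      D ∘ wordBasis w = fun i => d (w i) • wordBasis w i := by
    intro n w
    ext i j
    simp only [Function.comp, hD, wordBasis, Pi.smul_apply, smul_eq_mul, Pi.single_apply]
    split_ifs with h
    · rw [h]
    · simp
  ext1 n
  refine ContinuousMultilinearMap.ext_wordBasis fun w => ?_
  rw [FormalMultilinearSeries.compContinuousLinearMap_apply]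
  match n with
  | 0 =>
    rw [FormalMultilinearSeries.comp_coeff_zero _ _ _ 0, hp0, linearizationSeries_zero]
    rfl
  | 1 =>
    rw [FormalMultilinearSeries.comp_coeff_one, hp1, linearizationSeries_one]
    rfl
  | n + 2 =>
    rw [hDw, ContinuousMultilinearMap.map_smul_univ,
      FormalMultilinearSeries.comp_rightInv_aux1 (Nat.succ_pos _)]
    ext j
    have h1 := linearizationSeries_wordBasis d p (by omega : 2 ≤ n + 2) w j
    have hne : ∏ i, d (w i) - d j ≠ 0 := by
      rw [← prod_pow_wordExponent]
      exact sub_ne_zero.2 (hd _ (by rw [expDegree_wordExponent]; omega) j)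
    rw [eq_div_iff hne] at h1
    rw [Pi.add_apply, ← h1, hp1]
    simp only [continuousMultilinearCurryFin1_symm_apply, hD, Pi.smul_apply, smul_eq_mul]
    ring

/-! ### Convergence of the linearizing series -/

/-- A scalar majorant for the growth of the linearizing series, small divisors excluded. -/
noncomputable def linearizationMajorant (A r : ℝ) : ℕ → ℝ
  | 0 => 0
  | 1 => 1
  | n + 2 => A * ∑ c ∈ {c : Composition (n + 2) | 1 < c.length}.toFinset,
      r ^ c.length * ∏ j, if c.blocksFun j < n + 2 then
        linearizationMajorant A r (c.blocksFun j) else 0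

theorem linearizationMajorant_eq (A r : ℝ) {n : ℕ} (hn : 2 ≤ n) :
    linearizationMajorant A r n = A * ∑ c ∈ {c : Composition n | 1 < c.length}.toFinset,
      r ^ c.length * ∏ j, linearizationMajorant A r (c.blocksFun j) := by
  obtain ⟨n, rfl⟩ := Nat.exists_eq_add_of_le' hn
  rw [linearizationMajorant]
  congr 1
  refine Finset.sum_congr rfl fun c hc => ?_
  congr 1
  refine Finset.prod_congr rfl fun i _ => ?_
  have hc' : 1 < c.length := by simpa using hc
  exact if_pos ((Composition.ne_single_iff (by omega : 0 < n + 2)).1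
      (by rw [Ne, Composition.eq_single_iff_length]; omega) i)

theorem linearizationMajorant_nonneg {A r : ℝ} (hA : 0 ≤ A) (hr : 0 ≤ r) (n : ℕ) :
    0 ≤ linearizationMajorant A r n := by
  induction n using Nat.strong_induction_on with
  | _ n ih =>
    match n with
    | 0 => rw [linearizationMajorant]
    | 1 => rw [linearizationMajorant]; norm_num
    | n + 2 =>
      rw [linearizationMajorant]
      refine mul_nonneg hA (Finset.sum_nonneg fun c _ => mul_nonneg (by positivity)
        (Finset.prod_nonneg fun j _ => ?_))
      split_ifs with h
      · exact ih _ h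
      · rfl

/-- The partial sums `s` of `a ^ k * σ k` satisfy: the next one is at most `a + A * ∑ (r * s) ^ j`
over `j ≥ 2`. For small `a` this keeps them below `2 * a`, as for the inverse of a power series. -/
theorem exists_linearizationMajorant_le {A r : ℝ} (hA : 0 ≤ A) (hr : 0 ≤ r) :
    ∃ a : ℝ, 0 < a ∧ ∀ n, a ^ n * linearizationMajorant A r n ≤ 1 := by
  -- The three summands of the denominator yield, in turn, `r * (2 * a) ≤ 1 / 2`, `8 * A * r ^ 2 * a
  -- ≤ 1` and `2 * a ≤ 1`.
  set a : ℝ := 1 / (4 * r + 8 * A * r ^ 2 + 2) with ha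
  have hden : 0 < 4 * r + 8 * A * r ^ 2 + 2 := by positivity
  have ha0 : 0 < a := by positivity
  have ha1 : a * (4 * r + 8 * A * r ^ 2 + 2) = 1 := by rw [ha]; field_simp
  have hra : r * (2 * a) ≤ 1 / 2 := by nlinarith [mul_nonneg ha0.le (by positivity : 0 ≤ A * r ^ 2)]
  have hAa : 8 * A * r ^ 2 * a ≤ 1 := by nlinarith [mul_nonneg ha0.le hr]
  have h2a : 2 * a ≤ 1 := by
    nlinarith [mul_nonneg ha0.le hr, mul_nonneg ha0.le (by positivity : 0 ≤ A * r ^ 2)]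
  have hσ := linearizationMajorant_nonneg hA hr
  set σ := linearizationMajorant A r with hσd
  have hS : ∀ n, 1 ≤ n → ∑ k ∈ Finset.Ico 1 n, a ^ k * σ k ≤ 2 * a := by
    apply Nat.le_induction
    · simp [ha0.le]
    · intro n hn ih
      set s := ∑ k ∈ Finset.Ico 1 n, a ^ k * σ k with hs
      have hs0 : 0 ≤ s := Finset.sum_nonneg fun k _ => mul_nonneg (by positivity) (hσ k)
      have hrs : r * s ≤ 1 / 2 := (mul_le_mul_of_nonneg_left ih hr).trans hra
      have hrs0 : 0 ≤ r * s := mul_nonneg hr hs0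
      have h1 := FormalMultilinearSeries.radius_right_inv_pos_of_radius_pos_aux1 n σ hσ hr ha0.le
      have h2 : ∑ j ∈ Finset.Ico 2 (n + 1), r ^ j * s ^ j ≤ 2 * (r * s) ^ 2 := by
        simp only [← mul_pow]
        rw [geom_sum_Ico' (by linarith) (by omega), div_le_iff₀ (by linarith)]
        nlinarith [pow_nonneg hrs0 (n + 1), pow_nonneg hrs0 2]
      calc ∑ k ∈ Finset.Ico 1 (n + 1), a ^ k * σ k
          = a + ∑ k ∈ Finset.Ico 2 (n + 1), a ^ k * σ k := by
            rw [← Finset.sum_Ico_consecutive _ one_le_two (by omega)]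
            have : σ 1 = 1 := by rw [hσd, linearizationMajorant]
            rw [show Finset.Ico 1 2 = {1} from rfl, Finset.sum_singleton, this, pow_one, mul_one]
        _ = a + A * ∑ k ∈ Finset.Ico 2 (n + 1), a ^ k *
              ∑ c ∈ {c : Composition k | 1 < c.length}.toFinset,
                r ^ c.length * ∏ j, σ (c.blocksFun j) := by
            rw [Finset.mul_sum]
            congr 1
            refine Finset.sum_congr rfl fun k hk => ?_
            rw [hσd, linearizationMajorant_eq A r (Finset.mem_Ico.1 hk).1]
            ring
        _ ≤ a + A * (2 * (r * s) ^ 2) := by gcongr; exact h1.trans h2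
        _ ≤ a + A * (2 * (r * (2 * a)) ^ 2) := by gcongr
        _ = a + (8 * A * r ^ 2 * a) * a := by ring
        _ ≤ 2 * a := by nlinarith
  refine ⟨a, ha0, fun n => ?_⟩
  rcases Nat.eq_zero_or_pos n with rfl | hn
  · simp [hσd, linearizationMajorant]
  · refine le_trans ?_ ((hS (n + 1) (by omega)).trans h2a)
    exact Finset.single_le_sum (f := fun k => a ^ k * σ k)
      (fun k _ => mul_nonneg (by positivity) (hσ k)) (by simp; omega)

/-- Each composition in the recursion grafts the trees of its blocks onto a new root carrying the
current divisor. A single tree with maximal product serves as a bound for all compositions, whose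
number is absorbed by the majorant. -/
theorem norm_linearizationSeries_wordBasis_le {b : (Fin 2 → ℕ) → ℝ} (hb : ∀ k, 0 ≤ b k)
    {A C r : ℝ} (hA : 0 ≤ A) (hC : 0 ≤ C) (hr : 0 ≤ r) (hp : ∀ n, ‖p n‖ ≤ C * r ^ n)
    (hd : ∀ k : Fin 2 → ℕ, 2 ≤ expDegree k → ∀ j, ‖∏ i, d i ^ k i - d j‖⁻¹ ≤ A * b k)
    (n : ℕ) (hn : 1 ≤ n) (w : Fin n → Fin 2) :
    ∃ S, DivisorTree b (wordExponent w) S ∧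
      ‖linearizationSeries d p n (wordBasis w)‖ ≤ linearizationMajorant (A * C) r n * S.prod := by
  induction n using Nat.strong_induction_on with
  | _ n ih =>
    rcases (by omega : n = 1 ∨ 2 ≤ n) with rfl | hn2
    · refine ⟨0, ?_, ?_⟩
      · have : wordExponent w = Pi.single (w 0) 1 := by simp [wordExponent]
        rw [this]
        exact DivisorTree.leaf _
      · rw [linearizationSeries_one, linearizationMajorant]
        simp only [continuousMultilinearCurryFin1_symm_apply, wordBasis,
          ContinuousLinearMap.id_apply, Multiset.prod_zero, mul_one]
        rw [pi_norm_le_iff_of_nonneg zero_le_one]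
        intro i
        by_cases h : i = w 0 <;> simp [h]
    · set σ := linearizationMajorant (A * C) r with hσd
      have hσ := linearizationMajorant_nonneg (mul_nonneg hA hC) hr
      set I := {c : Composition n | 1 < c.length}.toFinset with hI
      have hblock : ∀ c ∈ I, ∀ i, c.blocksFun i < n := by
        intro c hc
        have hc' : 1 < c.length := by simpa [hI] using hc
        exact (Composition.ne_single_iff (by omega : 0 < n)).1
          (by rw [Ne, Composition.eq_single_iff_length]; omega)
      -- The trees are chosen for every composition, with an arbitrary value outside `I`, so that
      -- `S` is a total function.
      have key : ∀ c : Composition n, ∃ S : Fin c.length → Multiset ℝ, c ∈ I → ∀ i,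
          DivisorTree b (wordExponent (w ∘ c.embedding i)) (S i) ∧
          ‖linearizationSeries d p (c.blocksFun i) (wordBasis (w ∘ c.embedding i))‖ ≤
            σ (c.blocksFun i) * (S i).prod := by
        intro c
        by_cases hc : c ∈ I
        · choose S hS using fun i => ih (c.blocksFun i) (hblock c hc i) (c.one_le_blocksFun i)
            (w ∘ c.embedding i)
          exact ⟨S, fun _ i => hS i⟩
        · exact ⟨fun _ => 0, fun h => absurd h hc⟩
      choose S hS using key
      have hIne : I.Nonempty := ⟨Composition.ones n, by simp [hI]; omega⟩
      obtain ⟨c₀, hc₀, hmax⟩ := I.exists_max_image (fun c => (∑ i, S c i).prod) hIne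
      set P := (∑ i, S c₀ i).prod with hP
      have htree : DivisorTree b (wordExponent w) (b (wordExponent w) ::ₘ ∑ i, S c₀ i) := by
        have := DivisorTree.node (b := b) c₀.length (by
          have : 1 < c₀.length := by simpa [hI] using hc₀
          exact this)
          (fun i => wordExponent (w ∘ c₀.embedding i)) (S c₀) fun i => (hS c₀ hc₀ i).1
        rwa [sum_wordExponent_embedding] at this
      have hP0 : 0 ≤ P := Multiset.prod_nonneg fun x hx =>
        htree.nonneg_of_mem hb x (Multiset.mem_cons_of_mem hx)
      refine ⟨_, htree, ?_⟩
      have hsum : ‖∑ c ∈ I, p c.length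
          ((linearizationSeries d p).applyComposition c (wordBasis w))‖ ≤
          (∑ c ∈ I, r ^ c.length * ∏ j, σ (c.blocksFun j)) * (C * P) := by
        rw [Finset.sum_mul]
        refine norm_sum_le_of_le _ fun c hc => ?_
        calc ‖p c.length ((linearizationSeries d p).applyComposition c (wordBasis w))‖
            ≤ ‖p c.length‖ * ∏ i, ‖(linearizationSeries d p).applyComposition c (wordBasis w) i‖ :=
              ContinuousMultilinearMap.le_opNorm _ _
          _ ≤ (C * r ^ c.length) * ∏ i, (σ (c.blocksFun i) * (S c i).prod) := by
              refine mul_le_mul (hp _) (Finset.prod_le_prod (fun _ _ => norm_nonneg _)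
                fun i _ => (hS c hc i).2) (Finset.prod_nonneg fun _ _ => norm_nonneg _)
                (by positivity)
          _ = (C * r ^ c.length) * (∏ i, σ (c.blocksFun i)) * (∑ i, S c i).prod := by
              rw [Finset.prod_mul_distrib, Multiset.prod_sum]
              ring
          _ ≤ (C * r ^ c.length) * (∏ i, σ (c.blocksFun i)) * P := by
              refine mul_le_mul_of_nonneg_left (hmax c hc) (mul_nonneg (by positivity) ?_)
              exact Finset.prod_nonneg fun i _ => hσ _
          _ = _ := by ring
      have hs0 : 0 ≤ ∑ c ∈ I, r ^ c.length * ∏ j, σ (c.blocksFun j) :=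
        Finset.sum_nonneg fun c _ => mul_nonneg (by positivity)
          (Finset.prod_nonneg fun i _ => hσ _)
      have hb0 := hb (wordExponent w)
      rw [hσd, linearizationMajorant_eq _ _ hn2, ← hσd, Multiset.prod_cons, ← hP]
      rw [pi_norm_le_iff_of_nonneg (mul_nonneg (mul_nonneg (mul_nonneg hA hC) hs0)
        (mul_nonneg hb0 hP0))]
      intro j
      rw [linearizationSeries_wordBasis d p hn2, norm_div, div_eq_mul_inv, ← prod_pow_wordExponent]
      have h1 := (norm_le_pi_norm _ j).trans hsum
      have h2 := hd (wordExponent w) (by rw [expDegree_wordExponent]; exact hn2) j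
      have h3 := mul_le_mul h1 h2 (inv_nonneg.2 (norm_nonneg _))
        (mul_nonneg hs0 (mul_nonneg hC hP0))
      refine h3.trans (le_of_eq ?_)
      ring

theorem radius_linearizationSeries_pos {b : (Fin 2 → ℕ) → ℝ} (hb : ∀ k, 0 ≤ b k)
    {A B : ℝ} (hA : 0 ≤ A) (hB : 0 < B) (hp : 0 < p.radius)
    (hd : ∀ k : Fin 2 → ℕ, 2 ≤ expDegree k → ∀ j, ‖∏ i, d i ^ k i - d j‖⁻¹ ≤ A * b k)
    (htree : ∀ k S, DivisorTree b k S → S.prod ≤ B ^ expDegree k) :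
    0 < (linearizationSeries d p).radius := by
  obtain ⟨C, r, hC, hr, hle⟩ := p.le_mul_pow_of_radius_pos hp
  obtain ⟨a, ha, hmaj⟩ := exists_linearizationMajorant_le (mul_nonneg hA hC.le) hr.le
  -- The factor `2` pays for passing from basis words to the operator norm, `B` for the tree
  -- products and `a` for the majorant.
  set ρ : NNReal := ⟨a / (2 * B), by positivity⟩ with hρ
  have hρ0 : (0 : ENNReal) < ρ := by
    rw [ENNReal.coe_pos]
    exact (by positivity : 0 < a / (2 * B))
  refine hρ0.trans_le (FormalMultilinearSeries.le_radius_of_bound _ 1 fun n => ?_)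
  rcases Nat.eq_zero_or_pos n with rfl | hn
  · rw [linearizationSeries_zero]; simp
  have hσ := linearizationMajorant_nonneg (mul_nonneg hA hC.le) hr.le n
  have h1 : ‖linearizationSeries d p n‖ ≤
      2 ^ n * (linearizationMajorant (A * C) r n * B ^ n) := by
    refine ContinuousMultilinearMap.norm_le_of_wordBasis _ (by positivity) fun w => ?_
    obtain ⟨S, hS, hw⟩ := norm_linearizationSeries_wordBasis_le d p hb hA hC.le hr.le hle hd n hn w
    refine hw.trans (mul_le_mul_of_nonneg_left ?_ hσ)
    have := htree _ _ hS
    rwa [expDegree_wordExponent] at this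
  calc ‖linearizationSeries d p n‖ * (ρ : ℝ) ^ n
      ≤ 2 ^ n * (linearizationMajorant (A * C) r n * B ^ n) * (a / (2 * B)) ^ n := by
        exact mul_le_mul_of_nonneg_right h1 (by positivity)
    _ = a ^ n * linearizationMajorant (A * C) r n := by
        rw [div_pow, mul_pow]; field_simp
    _ ≤ 1 := hmaj n

end LinearizationSeries


/-! ### Small divisors of a Diophantine pair -/

/-- A multiplicative form of the Diophantine condition, with an integral exponent. -/
theorem IsDiophantinePair.exists_le_norm_div_sub_one {d : Fin 2 → ℂ} (hd0 : ∀ j, d j ≠ 0)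
    (h : IsDiophantinePair (d 0) (d 1)) :
    ∃ (κ : ℝ) (e : ℕ), 0 < κ ∧ ∀ k : Fin 2 → ℕ, 2 ≤ expDegree k → ∀ j,
      κ ≤ ‖(∏ i, d i ^ k i) / d j - 1‖ * (expDegree k : ℝ) ^ e := by
  obtain ⟨K, c, hK, hc, hKc⟩ := h
  have hn : ∀ j, 0 < ‖d j‖ := fun j => norm_pos_iff.2 (hd0 j)
  refine ⟨K / (‖d 0‖ + ‖d 1‖), ⌈c⌉₊, div_pos hK (add_pos (hn 0) (hn 1)), fun k hk j => ?_⟩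
  have hdeg : expDegree k = k 0 + k 1 := by simp [expDegree]
  have hprod : ∏ i, d i ^ k i = d 0 ^ k 0 * d 1 ^ k 1 := by simp
  have hbase : K * (expDegree k : ℝ) ^ (-c) ≤ ‖∏ i, d i ^ k i - d j‖ := by
    have := hKc (k 0) (k 1) (by omega)
    rw [hdeg, hprod, norm_sub_rev]
    push_cast
    fin_cases j
    exacts [this.1, this.2]
  have hpos : (1 : ℝ) ≤ expDegree k := by exact_mod_cast (by omega : 1 ≤ expDegree k)
  have hpow : (1 : ℝ) ≤ (expDegree k : ℝ) ^ (-c) * (expDegree k : ℝ) ^ ⌈c⌉₊ := by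
    rw [← Real.rpow_natCast, ← Real.rpow_add (by linarith)]
    exact Real.one_le_rpow hpos (by linarith [Nat.le_ceil c])
  have hdj : ‖d j‖ ≤ ‖d 0‖ + ‖d 1‖ := by
    fin_cases j
    · exact le_add_of_nonneg_right (hn 1).le
    · exact le_add_of_nonneg_left (hn 0).le
  have hdiv : (∏ i, d i ^ k i) / d j - 1 = (∏ i, d i ^ k i - d j) / d j := by
    field_simp [hd0 j]
  rw [hdiv, norm_div]
  calc K / (‖d 0‖ + ‖d 1‖) ≤ K / ‖d j‖ := div_le_div_of_nonneg_left hK.le (hn j) hdj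
    _ ≤ K * ((expDegree k : ℝ) ^ (-c) * (expDegree k : ℝ) ^ ⌈c⌉₊) / ‖d j‖ := by
        have := hn j
        gcongr
        exact le_mul_of_one_le_right hK.le hpow
    _ = K * (expDegree k : ℝ) ^ (-c) / ‖d j‖ * (expDegree k : ℝ) ^ ⌈c⌉₊ := by ring
    _ ≤ _ := by gcongr

theorem norm_div_sub_one_le {x y : ℂ} {μ : ℝ} (hx : ‖x - 1‖ ≤ μ) (hy : ‖y - 1‖ ≤ μ)
    (hμ : μ ≤ 1 / 2) : ‖x / y - 1‖ ≤ 4 * μ := by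
  have h1 : 1 / 2 ≤ ‖y‖ := by
    have := norm_sub_norm_le (1 : ℂ) (1 - y)
    rw [norm_one, sub_sub_cancel, norm_sub_rev] at this
    linarith
  have hy0 : y ≠ 0 := norm_pos_iff.1 (by linarith)
  have h2 : x / y - 1 = ((x - 1) - (y - 1)) / y := by field_simp; ring
  have h3 : ‖(x - 1) - (y - 1)‖ ≤ 2 * μ := (norm_sub_le _ _).trans (by linarith)
  have hμ0 : 0 ≤ μ := (norm_nonneg _).trans hx
  rw [h2, norm_div, div_le_iff₀ (by linarith)]
  nlinarith

/-- The inverse small divisors attached to Diophantine multipliers satisfy the hypotheses of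
`DivisorTree.prod_le`. -/
theorem IsDiophantinePair.exists_inverse_divisor_bounds {d : Fin 2 → ℂ} (hd0 : ∀ j, d j ≠ 0)
    (h : IsDiophantinePair (d 0) (d 1)) :
    ∃ (b : (Fin 2 → ℕ) → ℝ) (A B : ℝ), (∀ k, 0 ≤ b k) ∧ 0 ≤ A ∧ 0 < B ∧
      (∀ k : Fin 2 → ℕ, 2 ≤ expDegree k → ∀ j, ‖∏ i, d i ^ k i - d j‖⁻¹ ≤ A * b k) ∧
      ∀ k S, DivisorTree b k S → S.prod ≤ B ^ expDegree k := by
  obtain ⟨κ, e, hκ, hle⟩ := h.exists_le_norm_div_sub_one hd0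
  set m : (Fin 2 → ℕ) → ℂ := fun k => ∏ i, d i ^ k i with hm
  have hm0 : ∀ k, m k ≠ 0 := fun k => Finset.prod_ne_zero_iff.2 fun i _ => pow_ne_zero _ (hd0 i)
  -- The worse of the two components is taken, so that the weight depends on the exponent alone.
  set b : (Fin 2 → ℕ) → ℝ := fun k => max ‖m k / d 0 - 1‖⁻¹ ‖m k / d 1 - 1‖⁻¹ with hb
  have hbj : ∀ k j, ‖m k / d j - 1‖⁻¹ ≤ b k := by
    intro k j
    fin_cases j
    exacts [le_max_left _ _, le_max_right _ _]
  have hbex : ∀ k, ∃ j, b k = ‖m k / d j - 1‖⁻¹ := by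
    intro k
    rcases max_choice ‖m k / d 0 - 1‖⁻¹ ‖m k / d 1 - 1‖⁻¹ with h | h
    exacts [⟨0, h⟩, ⟨1, h⟩]
  have hb0 : ∀ k, 0 ≤ b k := fun k => le_max_of_le_left (inv_nonneg.2 (norm_nonneg _))
  have hpos : ∀ k, 2 ≤ expDegree k → ∀ j, 0 < ‖m k / d j - 1‖ := by
    intro k hk j
    have h1 := hle k hk j
    by_contra h0
    rw [le_antisymm (not_lt.1 h0) (norm_nonneg _), zero_mul] at h1
    linarith
  have hinv : ∀ k, 2 ≤ expDegree k → ∀ j, ‖m k / d j - 1‖⁻¹ ≤ κ⁻¹ * (expDegree k : ℝ) ^ e := by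
    intro k hk j
    rw [inv_le_iff_one_le_mul₀ (hpos k hk j), mul_assoc, inv_mul_eq_div, le_div_iff₀ hκ, one_mul,
      mul_comm]
    exact hle k hk j
  -- The `2` covers the case where one of the two divisors is at least `1 / 2`; the second summand
  -- covers the case where both are smaller.
  set C : ℝ := 2 + 4 * κ⁻¹ * 2 ^ e with hC
  have hC1 : 1 ≤ C := by
    have : 0 ≤ 4 * κ⁻¹ * 2 ^ e := by positivity
    linarith
  have hκC : κ⁻¹ ≤ C := by
    have h1 : (1 : ℝ) ≤ 2 ^ e := one_le_pow₀ (by norm_num)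
    have h2 : 0 < κ⁻¹ := by positivity
    nlinarith
  refine ⟨b, ‖d 0‖⁻¹ + ‖d 1‖⁻¹, C * (2 ^ e) ^ 4, hb0, by positivity, by positivity, ?_, ?_⟩
  · intro k hk j
    have h1 : m k - d j = d j * (m k / d j - 1) := by field_simp [hd0 j]
    have h2 : ‖d j‖⁻¹ ≤ ‖d 0‖⁻¹ + ‖d 1‖⁻¹ := by
      fin_cases j
      · exact le_add_of_nonneg_right (inv_nonneg.2 (norm_nonneg _))
      · exact le_add_of_nonneg_left (inv_nonneg.2 (norm_nonneg _))
    change ‖m k - d j‖⁻¹ ≤ _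
    rw [h1, norm_mul, mul_inv]
    exact mul_le_mul h2 (hbj k j) (inv_nonneg.2 (norm_nonneg _)) (by positivity)
  · intro k S hS
    refine hS.prod_le hC1 hb0 ?_ ?_
    · intro k hk
      obtain ⟨j, hj⟩ := hbex k
      rw [hj]
      exact (hinv k hk j).trans (by gcongr)
    · intro k l hl hlk hne
      have hdeg : expDegree l < expDegree k := by
        by_contra hcon
        exact hne (eq_of_le_of_expDegree hlk (not_lt.1 hcon))
      have hk : 2 ≤ expDegree k := by omega
      obtain ⟨i, hi⟩ := hbex k
      obtain ⟨j, hj⟩ := hbex l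
      set δ : ℝ := (expDegree k : ℝ) - expDegree l with hδ
      have hδ1 : 1 ≤ δ := by
        have : (expDegree l : ℝ) + 1 ≤ expDegree k := by exact_mod_cast hdeg
        linarith
      have hδe : 1 ≤ δ ^ e := one_le_pow₀ hδ1
      set μ := max ‖m k / d i - 1‖ ‖m l / d j - 1‖ with hμ
      have hμ0 : 0 < μ := lt_max_of_lt_left (hpos k hk i)
      have hmin : min (b k) (b l) ≤ μ⁻¹ := by
        rw [hi, hj]
        rcases max_choice ‖m k / d i - 1‖ ‖m l / d j - 1‖ with h | h
        · rw [hμ, h]; exact min_le_left _ _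
        · rw [hμ, h]; exact min_le_right _ _
      refine hmin.trans ?_
      rcases le_or_gt (1 / 2) μ with hlarge | hsmall
      · calc μ⁻¹ ≤ (1 / 2)⁻¹ := inv_anti₀ (by norm_num) hlarge
          _ = 2 * 1 := by norm_num
          _ ≤ C * δ ^ e := by
            have : 0 ≤ 4 * κ⁻¹ * 2 ^ e := by positivity
            exact mul_le_mul (by linarith) hδe zero_le_one (by linarith)
      -- The quotient of the two near-resonances is the near-resonance of `q`, of degree `δ + 1 ≤ 2
      -- * δ`. The Diophantine bound at `q` therefore bounds `μ` from below.
      · set q : Fin 2 → ℕ := k - l + Pi.single j 1 with hq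
        have hmq : m q / d i = (m k / d i) / (m l / d j) := by
          have h1 : m q * m l = m k * d j := by
            have hkl : k = k - l + l := (tsub_add_cancel_of_le hlk).symm
            have h2 : m (Pi.single j 1) = d j := by
              rw [hm]
              change ∏ i, d i ^ (Pi.single j 1 : Fin 2 → ℕ) i = d j
              rw [Finset.prod_eq_single j]
              · simp
              · intro i _ hij; simp [hij]
              · simp
            have h3 : ∀ x y, m (x + y) = m x * m y := fun x y => by
              simp only [hm, Pi.add_apply, pow_add, Finset.prod_mul_distrib]
            have h4 : m k = m (k - l) * m l := by rw [← h3, ← hkl]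
            rw [hq, h3, h2, h4]
            ring
          have := hm0 l
          have := hd0 i
          have := hd0 j
          field_simp
          linear_combination h1
        have hqdeg : expDegree q = expDegree k - expDegree l + 1 := by
          have h0 : l 0 ≤ k 0 := hlk 0
          have h1 : l 1 ≤ k 1 := hlk 1
          have h2 := expDegree_single j
          simp only [expDegree, Fin.sum_univ_two, hq, Pi.add_apply, Pi.sub_apply] at h2 ⊢
          omega
        have hq2 : 2 ≤ expDegree q := by omega
        have h1 := hle q hq2 i
        have h2 : ‖m q / d i - 1‖ ≤ 4 * μ := by
          rw [hmq]
          exact norm_div_sub_one_le (le_max_left _ _) (le_max_right _ _) hsmall.le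
        have h3 : (expDegree q : ℝ) ≤ 2 * δ := by
          rw [hqdeg]
          push_cast [hdeg.le]
          linarith
        have h4 : κ ≤ 4 * μ * (2 * δ) ^ e := h1.trans (mul_le_mul h2
          (pow_le_pow_left₀ (by positivity) h3 _) (by positivity) (by positivity))
        calc μ⁻¹ ≤ 4 * κ⁻¹ * 2 ^ e * δ ^ e := by
              rw [inv_le_iff_one_le_mul₀ hμ0]
              have : 4 * κ⁻¹ * 2 ^ e * δ ^ e * μ = κ⁻¹ * (4 * μ * (2 * δ) ^ e) := by
                rw [mul_pow]; ring
              rw [this, inv_mul_eq_div, le_div_iff₀ hκ, one_mul]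
              exact h4
          _ ≤ C * δ ^ e := by gcongr; linarith

theorem IsDiophantinePair.nonresonant {d : Fin 2 → ℂ} (hd0 : ∀ j, d j ≠ 0)
    (h : IsDiophantinePair (d 0) (d 1)) (k : Fin 2 → ℕ) (hk : 2 ≤ expDegree k) (j : Fin 2) :
    ∏ i, d i ^ k i ≠ d j := by
  obtain ⟨κ, e, hκ, hle⟩ := h.exists_le_norm_div_sub_one hd0
  intro heq
  have := hle k hk j
  rw [heq, div_self (hd0 j), sub_self, norm_zero, zero_mul] at this
  linarith

/-! ### Siegel's theorem and uniqueness of linearizations -/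

theorem HasFPowerSeriesAt.eventuallyEq_of_same_series {f g : (Fin 2 → ℂ) → (Fin 2 → ℂ)}
    {p : FormalMultilinearSeries ℂ (Fin 2 → ℂ) (Fin 2 → ℂ)} {x : Fin 2 → ℂ}
    (hf : HasFPowerSeriesAt f p x) (hg : HasFPowerSeriesAt g p x) : f =ᶠ[𝓝 x] g := by
  have h := hf.sub hg
  rw [sub_self] at h
  filter_upwards [h.eventually_eq_zero] with z hz
  exact sub_eq_zero.1 hz

/-- Siegel's linearization theorem in dimension two for a diagonal linear part. -/
theorem exists_linearization_of_diagonal {f : (Fin 2 → ℂ) → (Fin 2 → ℂ)} (hf : AnalyticAt ℂ f 0)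
    (hf0 : f 0 = 0) {d : Fin 2 → ℂ} {D : (Fin 2 → ℂ) →L[ℂ] (Fin 2 → ℂ)}
    (hD : ∀ v j, D v j = d j * v j) (hfD : HasFDerivAt f D 0) (hd0 : ∀ j, d j ≠ 0)
    (hdio : IsDiophantinePair (d 0) (d 1)) :
    ∃ H : (Fin 2 → ℂ) → (Fin 2 → ℂ), AnalyticAt ℂ H 0 ∧ H 0 = 0 ∧
      HasFDerivAt H (ContinuousLinearMap.id ℂ (Fin 2 → ℂ)) 0 ∧
      ∀ᶠ z in 𝓝 0, f (H z) = H (D z) := by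
  obtain ⟨p, hp⟩ := hf
  have hp0 : p 0 = 0 := by
    ext1 v
    rw [hp.coeff_zero, hf0]
    rfl
  have hp1 : p 1 = (continuousMultilinearCurryFin1 ℂ (Fin 2 → ℂ) (Fin 2 → ℂ)).symm D := by
    rw [LinearIsometryEquiv.eq_symm_apply]
    exact hp.hasFDerivAt.unique hfD
  obtain ⟨b, A, B, hb, hA, hB, hdiv, htree⟩ := hdio.exists_inverse_divisor_bounds hd0
  set q := linearizationSeries d p with hq
  have hrad : 0 < q.radius := radius_linearizationSeries_pos d p hb hA hB hp.radius_pos hdiv htree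
  have hH : HasFPowerSeriesAt q.sum q 0 := (q.hasFPowerSeriesOnBall hrad).hasFPowerSeriesAt
  have hH0 : q.sum 0 = 0 := by
    rw [← hH.coeff_zero 0, hq, linearizationSeries_zero]
    rfl
  have hH1 : HasFDerivAt q.sum (ContinuousLinearMap.id ℂ (Fin 2 → ℂ)) 0 := by
    have := hH.hasFDerivAt
    rwa [hq, linearizationSeries_one, LinearIsometryEquiv.apply_symm_apply, ← hq] at this
  refine ⟨q.sum, hH.analyticAt, hH0, hH1, ?_⟩
  have h1 : HasFPowerSeriesAt (f ∘ q.sum) (p.comp q) 0 :=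
    HasFPowerSeriesAt.comp (by rwa [hH0]) hH
  have h2 : HasFPowerSeriesAt (q.sum ∘ D) (q.compContinuousLinearMap D) 0 :=
    HasFPowerSeriesAt.compContinuousLinearMap (by rwa [map_zero])
  rw [← comp_linearizationSeries d p hD (hdio.nonresonant hd0) hp0 hp1] at h2
  exact h1.eventuallyEq_of_same_series h2

/-- A germ without linear part commuting with a nonresonant diagonal linear map vanishes. -/
theorem eventually_eq_zero_of_commute_diagonal {g : (Fin 2 → ℂ) → (Fin 2 → ℂ)}
    (hg : AnalyticAt ℂ g 0) (hg0 : g 0 = 0) (hg1 : fderiv ℂ g 0 = 0) {d : Fin 2 → ℂ}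
    {D : (Fin 2 → ℂ) ≃L[ℂ] (Fin 2 → ℂ)} (hD : ∀ v j, D v j = d j * v j)
    (hd : ∀ k : Fin 2 → ℕ, 2 ≤ expDegree k → ∀ j, ∏ i, d i ^ k i ≠ d j)
    (hcomm : ∀ᶠ z in 𝓝 0, g (D z) = D (g z)) : ∀ᶠ z in 𝓝 0, g z = 0 := by
  have hzero : ∀ n, iteratedFDeriv ℂ n g 0 = 0 := by
    intro n
    rcases (by omega : n = 0 ∨ n = 1 ∨ 2 ≤ n) with rfl | rfl | hn
    · ext1 v
      rw [iteratedFDeriv_zero_apply, hg0]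
      rfl
    · ext1 v
      rw [iteratedFDeriv_one_apply, hg1]
      rfl
    · have h1 : iteratedFDeriv ℂ n (g ∘ D) 0 =
          (iteratedFDeriv ℂ n g 0).compContinuousLinearMap
            fun _ => (D : (Fin 2 → ℂ) →L[ℂ] (Fin 2 → ℂ)) := by
        have := D.iteratedFDerivWithin_comp_right g uniqueDiffOn_univ (x := 0) (Set.mem_univ _) n
        simpa only [Set.preimage_univ, iteratedFDerivWithin_univ, map_zero] using this
      have h2 : iteratedFDeriv ℂ n (D ∘ g) 0 =
          (D : (Fin 2 → ℂ) →L[ℂ] (Fin 2 → ℂ)).compContinuousMultilinearMap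
            (iteratedFDeriv ℂ n g 0) := D.iteratedFDeriv_comp_left
      have h3 : iteratedFDeriv ℂ n (g ∘ D) 0 = iteratedFDeriv ℂ n (D ∘ g) 0 :=
        (Filter.EventuallyEq.iteratedFDeriv ℂ hcomm n).eq_of_nhds
      refine ContinuousMultilinearMap.ext_wordBasis fun w => ?_
      -- On a word, commutation reads `(∏ i, d (w i)) * T j = d j * T j` for the `n`-th derivative
      -- `T`; nonresonance forces `T j = 0`.
      have h4 := congrArg (fun T => T (wordBasis w)) (h1.symm.trans (h3.trans h2))
      have hDw : (fun i => D (wordBasis w i)) = fun i => d (w i) • wordBasis w i := by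
        ext i j
        simp only [hD, wordBasis, Pi.smul_apply, smul_eq_mul, Pi.single_apply]
        split_ifs with h
        · rw [h]
        · simp
      simp only [ContinuousMultilinearMap.compContinuousLinearMap_apply,
        ContinuousLinearEquiv.coe_coe, hDw, ContinuousMultilinearMap.map_smul_univ,
        ContinuousLinearMap.compContinuousMultilinearMap_coe, Function.comp] at h4
      ext j
      have h5 := congrFun h4 j
      rw [hD, Pi.smul_apply, smul_eq_mul, ← prod_pow_wordExponent] at h5
      have h6 := hd (wordExponent w) (by rw [expDegree_wordExponent]; exact hn) j
      rw [_root_.zero_apply, Pi.zero_apply]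
      by_contra h7
      exact h6 (mul_right_cancel₀ h7 h5)
  obtain ⟨p, r, hp⟩ := hg
  have hball : Metric.eball (0 : Fin 2 → ℂ) r ∈ 𝓝 0 := Metric.eball_mem_nhds _ hp.r_pos
  filter_upwards [hball] with z hz
  have := hp.hasSum_iteratedFDeriv hz
  simp only [hzero, _root_.zero_apply, smul_zero, zero_add] at this
  exact (this.unique hasSum_zero)

/-- Siegel's linearization theorem in dimension two for a diagonalizable linear part. -/
theorem exists_linearization_of_conj {f : (Fin 2 → ℂ) → (Fin 2 → ℂ)} (hf : AnalyticAt ℂ f 0)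
    (hf0 : f 0 = 0) {d : Fin 2 → ℂ} {P L : (Fin 2 → ℂ) ≃L[ℂ] (Fin 2 → ℂ)}
    (hL : ∀ v j, P.symm (L (P v)) j = d j * v j)
    (hfL : HasFDerivAt f (L : (Fin 2 → ℂ) →L[ℂ] (Fin 2 → ℂ)) 0) (hd0 : ∀ j, d j ≠ 0)
    (hdio : IsDiophantinePair (d 0) (d 1)) :
    ∃ H : (Fin 2 → ℂ) → (Fin 2 → ℂ), AnalyticAt ℂ H 0 ∧ H 0 = 0 ∧
      HasFDerivAt H (ContinuousLinearMap.id ℂ (Fin 2 → ℂ)) 0 ∧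
      ∀ᶠ z in 𝓝 0, f (H z) = H (L z) := by
  set D : (Fin 2 → ℂ) →L[ℂ] (Fin 2 → ℂ) := (P.symm : (Fin 2 → ℂ) →L[ℂ] (Fin 2 → ℂ)) ∘L
    ((L : (Fin 2 → ℂ) →L[ℂ] (Fin 2 → ℂ)) ∘L (P : (Fin 2 → ℂ) →L[ℂ] (Fin 2 → ℂ))) with hDdef
  have hP0 : P 0 = 0 := map_zero P
  have hPs0 : P.symm 0 = 0 := map_zero P.symm
  obtain ⟨H, hH, hH0, hH1, hHD⟩ := exists_linearization_of_diagonal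
    (f := fun z => P.symm (f (P z))) (d := d) (D := D)
    ((P.symm.analyticAt _).comp (AnalyticAt.comp (by rwa [hP0]) (P.analyticAt _)))
    (by simp only [hP0, hf0, hPs0]) hL
    (P.symm.hasFDerivAt.comp 0
      (HasFDerivAt.comp 0 (by rwa [hP0] : HasFDerivAt f _ (P 0)) P.hasFDerivAt)) hd0 hdio
  have hHP : AnalyticAt ℂ H (P.symm 0) := by rwa [hPs0]
  refine ⟨fun z => P (H (P.symm z)), (P.analyticAt _).comp (hHP.comp (P.symm.analyticAt _)),
    by simp only [hPs0, hH0, hP0], ?_, ?_⟩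
  · have h1 : HasFDerivAt H (ContinuousLinearMap.id ℂ (Fin 2 → ℂ)) (P.symm 0) := by rwa [hPs0]
    have h2 := P.hasFDerivAt.comp 0 (h1.comp 0 P.symm.hasFDerivAt)
    have h3 : (P : (Fin 2 → ℂ) →L[ℂ] (Fin 2 → ℂ)) ∘L (ContinuousLinearMap.id ℂ (Fin 2 → ℂ) ∘L
        (P.symm : (Fin 2 → ℂ) →L[ℂ] (Fin 2 → ℂ))) = ContinuousLinearMap.id ℂ _ := by
      ext1 v
      simp
    rwa [h3] at h2
  · have : Tendsto P.symm (𝓝 0) (𝓝 0) := by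
      simpa only [hPs0] using P.symm.continuous.tendsto 0
    filter_upwards [this.eventually hHD] with z hz
    have h1 := congrArg P hz
    simpa [hDdef] using h1

theorem eventually_eq_zero_of_commute_conj {g : (Fin 2 → ℂ) → (Fin 2 → ℂ)}
    (hg : AnalyticAt ℂ g 0) (hg0 : g 0 = 0)
    (hg1 : HasFDerivAt g (0 : (Fin 2 → ℂ) →L[ℂ] (Fin 2 → ℂ)) 0) {d : Fin 2 → ℂ}
    {P L : (Fin 2 → ℂ) ≃L[ℂ] (Fin 2 → ℂ)} (hL : ∀ v j, P.symm (L (P v)) j = d j * v j)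
    (hd : ∀ k : Fin 2 → ℕ, 2 ≤ expDegree k → ∀ j, ∏ i, d i ^ k i ≠ d j)
    (hcomm : ∀ᶠ z in 𝓝 0, g (L z) = L (g z)) : ∀ᶠ z in 𝓝 0, g z = 0 := by
  set D := (P.trans L).trans P.symm with hDdef
  have hP0 : P 0 = 0 := map_zero P
  have hPs0 : P.symm 0 = 0 := map_zero P.symm
  have hPt : Tendsto P (𝓝 0) (𝓝 0) := by simpa only [hP0] using P.continuous.tendsto 0
  have hPst : Tendsto P.symm (𝓝 0) (𝓝 0) := by
    simpa only [hPs0] using P.symm.continuous.tendsto 0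
  have h := eventually_eq_zero_of_commute_diagonal (g := fun z => P.symm (g (P z))) (d := d)
    (D := D) ((P.symm.analyticAt _).comp (AnalyticAt.comp (by rwa [hP0]) (P.analyticAt _)))
    (by simp only [hP0, hg0, hPs0])
    (by
      have h1 : HasFDerivAt g (0 : (Fin 2 → ℂ) →L[ℂ] (Fin 2 → ℂ)) (P 0) := by rwa [hP0]
      have h2 := P.symm.hasFDerivAt.comp 0 (h1.comp 0 P.hasFDerivAt)
      rw [ContinuousLinearMap.zero_comp, ContinuousLinearMap.comp_zero] at h2
      exact h2.fderiv) hL hd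
    (by
      filter_upwards [hPt.eventually hcomm] with z hz
      simpa [hDdef] using congrArg P.symm hz)
  filter_upwards [hPst.eventually h] with z hz
  simpa using congrArg P hz


/-! ### Two-by-two matrices and finite subgroups of `SU(2)` -/

theorem pow_succ_of_sub_smul_sq_eq_zero {A : Matrix (Fin 2) (Fin 2) ℂ} {a : ℂ}
    (hsq : (A - a • 1) * (A - a • 1) = 0) (m : ℕ) :
    A ^ (m + 1) = a ^ (m + 1) • 1 + ((m + 1 : ℕ) * a ^ m) • (A - a • 1) := by
  set N := A - a • (1 : Matrix (Fin 2) (Fin 2) ℂ) with hN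
  have hA : A = a • 1 + N := by rw [hN]; abel
  have hmul : ∀ x y : ℂ, (x • 1 + y • N) * (a • 1 + N) = (x * a) • 1 + (x + y * a) • N := by
    intro x y
    simp only [add_mul, mul_add, smul_mul_assoc, mul_smul_comm, one_mul, mul_one, hsq, smul_zero,
      add_zero]
    module
  induction m with
  | zero => simp [← hA]
  | succ m ih =>
    rw [pow_succ, ih]
    conv_lhs => rw [hA]
    rw [hmul, ← pow_succ]
    congr 2
    push_cast
    ring

/-- Put `N = A - a`. Then `1 = a ^ n + n * a ^ (n - 1) * N`, and multiplication by `N` gives `N = a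
^ n * N`. If `N ≠ 0`, then `a ^ n = 1`, and so `n * a ^ (n - 1) * N = 0`, impossible in
characteristic zero. -/
theorem sub_smul_one_eq_zero_of_pow_eq_one {A : Matrix (Fin 2) (Fin 2) ℂ} {a : ℂ} {n : ℕ}
    (hsq : (A - a • 1) * (A - a • 1) = 0) (hn : 0 < n) (hA : A ^ n = 1) : A - a • 1 = 0 := by
  set N := A - a • (1 : Matrix (Fin 2) (Fin 2) ℂ) with hN
  obtain ⟨m, rfl⟩ := Nat.exists_eq_succ_of_ne_zero hn.ne'
  have h1 := pow_succ_of_sub_smul_sq_eq_zero hsq m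
  rw [← hN] at h1
  rw [← Nat.succ_eq_add_one, hA] at h1
  have h2 : N = a ^ (m + 1) • N := by
    have := congrArg (· * N) h1
    simpa [add_mul, hsq] using this
  by_contra hN0
  have h3 : a ^ (m + 1) = 1 := by
    have : (a ^ (m + 1) - 1) • N = 0 := by rw [sub_smul, ← h2, one_smul, sub_self]
    exact sub_eq_zero.1 ((smul_eq_zero.1 this).resolve_right hN0)
  rw [Nat.succ_eq_add_one, h3, one_smul, left_eq_add] at h1
  rcases smul_eq_zero.1 h1 with h4 | h4
  · rcases mul_eq_zero.1 h4 with h5 | h5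
    · exact hn.ne' (by exact_mod_cast h5)
    · have : a = 0 := eq_zero_of_pow_eq_zero h5
      rw [this, zero_pow hn.ne'] at h3
      exact zero_ne_one h3
  · exact hN0 h4

/-- An element of finite order in `SL₂(ℂ)` with a nonzero fixed vector is trivial. -/
theorem eq_one_of_mulVec_eq_self {A : Matrix (Fin 2) (Fin 2) ℂ} (hdet : A.det = 1) {n : ℕ}
    (hn : 0 < n) (hA : A ^ n = 1) {v : Fin 2 → ℂ} (hv : v ≠ 0) (hAv : A *ᵥ v = v) : A = 1 := by
  have h1 : (A - 1).det = 0 :=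
    Matrix.exists_mulVec_eq_zero_iff.1 ⟨v, hv, by rw [sub_mulVec, hAv, one_mulVec, sub_self]⟩
  -- Eigenvalue `1` and determinant `1` force trace `2`; this is then Cayley–Hamilton.
  have h2 : (A - (1 : ℂ) • 1) * (A - (1 : ℂ) • 1) = 0 := by
    rw [one_smul]
    rw [det_fin_two] at hdet h1
    simp only [Matrix.sub_apply, one_apply_eq, ne_eq, zero_ne_one, not_false_eq_true, one_apply_ne,
      one_ne_zero, sub_zero] at h1
    have ht : A 0 0 + A 1 1 = 2 := by linear_combination hdet - h1
    ext i j
    fin_cases i <;> fin_cases j <;>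
      simp only [Fin.zero_eta, Fin.mk_one, mul_apply, Fin.sum_univ_two, Matrix.sub_apply, one_apply_eq,
        ne_eq, zero_ne_one, not_false_eq_true, one_apply_ne, one_ne_zero, sub_zero, Matrix.zero_apply,
        Fin.isValue]
    · linear_combination A 0 0 * ht - hdet
    · linear_combination A 0 1 * ht
    · linear_combination A 1 0 * ht
    · linear_combination A 1 1 * ht - hdet
  have := sub_smul_one_eq_zero_of_pow_eq_one h2 hn hA
  rwa [one_smul, sub_eq_zero] at this

/-- A matrix commuting with a nonzero nilpotent matrix differs from a scalar matrix by a nilpotent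
one. -/
theorem sq_eq_zero_of_commute_nilpotent {N A : Matrix (Fin 2) (Fin 2) ℂ} (hN0 : N ≠ 0)
    (hN : N * N = 0) (hc : N * A = A * N) :
    (A - ((A 0 0 + A 1 1) / 2) • 1) * (A - ((A 0 0 + A 1 1) / 2) • 1) = 0 := by
  have n00 := congrFun (congrFun hN 0) 0
  have n01 := congrFun (congrFun hN 0) 1
  have n10 := congrFun (congrFun hN 1) 0
  have n11 := congrFun (congrFun hN 1) 1
  have c00 := congrFun (congrFun hc 0) 0
  have c01 := congrFun (congrFun hc 0) 1
  have c10 := congrFun (congrFun hc 1) 0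
  simp only [mul_apply, Fin.sum_univ_two, Matrix.zero_apply] at n00 n01 n10 n11 c00 c01 c10
  have htr : N 0 0 + N 1 1 = 0 := by
    by_contra h
    have h01 : N 0 1 = 0 := by
      have : (N 0 0 + N 1 1) * N 0 1 = 0 := by linear_combination n01
      exact (mul_eq_zero.1 this).resolve_left h
    have h10 : N 1 0 = 0 := by
      have : (N 0 0 + N 1 1) * N 1 0 = 0 := by linear_combination n10
      exact (mul_eq_zero.1 this).resolve_left h
    rw [h01] at n00 n11
    have h00 : N 0 0 = 0 := by simpa using n00
    have h11 : N 1 1 = 0 := by simpa using n11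
    exact h (by rw [h00, h11, add_zero])
  have h11 : N 1 1 = -N 0 0 := by linear_combination htr
  rw [h11] at c01 c10 n01 n10
  -- The square of the traceless part of `A` is this scalar. Commutation makes that part
  -- proportional to `N`, hence nilpotent.
  have key : ((A 0 0 - A 1 1) / 2) ^ 2 + A 0 1 * A 1 0 = 0 := by
    set p := (A 0 0 - A 1 1) / 2 with hp
    have e1 : N 0 0 * A 0 1 = p * N 0 1 := by rw [hp]; linear_combination c01 / 2
    have e2 : N 0 0 * A 1 0 = p * N 1 0 := by rw [hp]; linear_combination -c10 / 2
    by_cases h01 : N 0 1 = 0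
    · by_cases h10 : N 1 0 = 0
      · exfalso
        apply hN0
        rw [h01] at n00
        have h00 : N 0 0 = 0 := by simpa using n00
        ext i j
        fin_cases i <;> fin_cases j
        exacts [h00, h01, h10, by simpa [h00] using h11]
      · have : N 1 0 ^ 2 * (p ^ 2 + A 0 1 * A 1 0) = 0 := by
          linear_combination -(p * N 1 0 + N 0 0 * A 1 0) * e2 + A 1 0 ^ 2 * n00 -
            N 1 0 * A 1 0 * c00
        exact (mul_eq_zero.1 this).resolve_left (pow_ne_zero _ h10)
    · have : N 0 1 ^ 2 * (p ^ 2 + A 0 1 * A 1 0) = 0 := by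
        linear_combination -(p * N 0 1 + N 0 0 * A 0 1) * e1 + A 0 1 ^ 2 * n00 +
          N 0 1 * A 0 1 * c00
      exact (mul_eq_zero.1 this).resolve_left (pow_ne_zero _ h01)
  ext i j
  fin_cases i <;> fin_cases j <;>
    simp [mul_apply, Fin.sum_univ_two, Matrix.sub_apply, Matrix.smul_apply]
  · linear_combination key
  · ring
  · ring
  · linear_combination key

/-- Distinct eigenvalues would give an eigenbasis, so the eigenvalue is double and Cayley–Hamilton
applies. The difference is nonzero because a scalar matrix is diagonal. -/
theorem exists_nilpotent_of_not_diagonalizable {A : Matrix (Fin 2) (Fin 2) ℂ}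
    (hA : ¬ IsDiagonalizableMatrix A) :
    ∃ a : ℂ, A - a • 1 ≠ 0 ∧ (A - a • 1) * (A - a • 1) = 0 := by
  obtain ⟨a, ha⟩ : ∃ a : ℂ, a * a - (A 0 0 + A 1 1) * a + (A 0 0 * A 1 1 - A 0 1 * A 1 0) = 0 := by
    obtain ⟨s, hs⟩ := IsAlgClosed.exists_eq_mul_self
      ((A 0 0 + A 1 1) ^ 2 - 4 * (A 0 0 * A 1 1 - A 0 1 * A 1 0))
    exact ⟨(A 0 0 + A 1 1 + s) / 2, by linear_combination -hs / 4⟩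
  refine ⟨a, fun h => hA ?_, ?_⟩
  · refine ⟨1, fun _ => a, ?_⟩
    rw [sub_eq_zero.1 h]
    simp [smul_one_eq_diagonal]
  set c := A 0 0 + A 1 1 - a with hc
  by_cases hac : a = c
  · have htr : A 0 0 + A 1 1 = 2 * a := by linear_combination (-1 : ℂ) * hac + hc
    ext i j
    fin_cases i <;> fin_cases j <;>
      simp [mul_apply, Fin.sum_univ_two, Matrix.sub_apply, Matrix.smul_apply]
    · linear_combination A 0 0 * htr - ha - a * htr
    · linear_combination A 0 1 * htr
    · linear_combination A 1 0 * htr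
    · linear_combination A 1 1 * htr - ha - a * htr
  · exfalso
    apply hA
    have hev : ∀ x : ℂ, x * x - (A 0 0 + A 1 1) * x + (A 0 0 * A 1 1 - A 0 1 * A 1 0) = 0 →
        ∃ v : Fin 2 → ℂ, v ≠ 0 ∧ A *ᵥ v = x • v := by
      intro x hx
      obtain ⟨v, hv, hv0⟩ := Matrix.exists_mulVec_eq_zero_iff.2
        (show (A - x • 1).det = 0 by
          rw [det_fin_two]
          simp [Matrix.sub_apply, Matrix.smul_apply]
          linear_combination hx)
      refine ⟨v, hv, ?_⟩
      rwa [sub_mulVec, smul_mulVec, one_mulVec, sub_eq_zero] at hv0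
    obtain ⟨v, hv, hAv⟩ := hev a ha
    obtain ⟨w, hw, hAw⟩ := hev c (by rw [hc]; linear_combination ha)
    set P : Matrix (Fin 2) (Fin 2) ℂ := of ![![v 0, w 0], ![v 1, w 1]] with hP
    have hPc : ∀ x : Fin 2 → ℂ, P *ᵥ x = x 0 • v + x 1 • w := by
      intro x
      ext i
      fin_cases i <;> simp [hP, mulVec, dotProduct, Fin.sum_univ_two] <;> ring
    have hdet : P.det ≠ 0 := by
      intro h0
      obtain ⟨x, hx, hx0⟩ := Matrix.exists_mulVec_eq_zero_iff.2 h0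
      rw [hPc] at hx0
      have h1 := congrArg (A *ᵥ ·) hx0
      simp only [mulVec_add, mulVec_smul, hAv, hAw, mulVec_zero] at h1
      have h2 : (x 1 * (c - a)) • w = 0 := by
        have h3 := congrArg (a • ·) hx0
        simp only [smul_add, smul_zero] at h3
        have h4 := h1.trans h3.symm
        ext i
        have := congrFun h4 i
        simp only [Pi.add_apply, Pi.smul_apply, smul_eq_mul, Pi.zero_apply] at this ⊢
        linear_combination this
      have h5 : x 1 = 0 := by
        rcases mul_eq_zero.1 ((smul_eq_zero.1 h2).resolve_right hw) with h | h
        · exact h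
        · exact absurd (sub_eq_zero.1 h).symm hac
      rw [h5, zero_smul, add_zero] at hx0
      have h6 : x 0 = 0 := (smul_eq_zero.1 hx0).resolve_right hv
      apply hx
      ext i
      fin_cases i
      exacts [h6, h5]
    set Q : GL (Fin 2) ℂ := GeneralLinearGroup.mkOfDetNeZero P hdet with hQ
    have hQP : (Q : Matrix (Fin 2) (Fin 2) ℂ) = P := rfl
    refine ⟨Q, ![a, c], ?_⟩
    have h1 : A * P = P * diagonal ![a, c] := by
      apply Matrix.toLin'.injective
      apply LinearMap.ext
      intro x
      simp only [toLin'_apply, ← mulVec_mulVec, hPc, mulVec_add, mulVec_smul, hAv, hAw,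
        mulVec_diagonal]
      ext i
      simp
      ring
    rw [hQP, ← h1, ← hQP, mul_assoc, Units.mul_inv, mul_one]

section FiniteSubgroup

variable (G : Subgroup (Matrix.specialUnitaryGroup (Fin 2) ℂ))

theorem exists_pow_eq_one_of_mem [Finite G] {g : Matrix.specialUnitaryGroup (Fin 2) ℂ}
    (hg : g ∈ G) : ∃ n, 0 < n ∧ (g : Matrix (Fin 2) (Fin 2) ℂ) ^ n = 1 := by
  refine ⟨orderOf (⟨g, hg⟩ : G), orderOf_pos _, ?_⟩
  have h := congrArg (fun x : G => ((x : Matrix.specialUnitaryGroup (Fin 2) ℂ) :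
    Matrix (Fin 2) (Fin 2) ℂ)) (pow_orderOf_eq_one (⟨g, hg⟩ : G))
  exact h

theorem det_specialUnitary (g : Matrix.specialUnitaryGroup (Fin 2) ℂ) :
    (g : Matrix (Fin 2) (Fin 2) ℂ).det = 1 := (mem_specialUnitaryGroup_iff.1 g.2).2

/-- Distinct elements of a finite subgroup of `SU(2)` have no common value at a nonzero vector. -/
theorem eq_of_mulVec_eq [Finite G] {g h : Matrix.specialUnitaryGroup (Fin 2) ℂ} (hg : g ∈ G)
    (hh : h ∈ G) {v : Fin 2 → ℂ} (hv : v ≠ 0)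
    (heq : (g : Matrix (Fin 2) (Fin 2) ℂ) *ᵥ v = (h : Matrix (Fin 2) (Fin 2) ℂ) *ᵥ v) : g = h := by
  have hk : g⁻¹ * h ∈ G := G.mul_mem (G.inv_mem hg) hh
  obtain ⟨n, hn, hpow⟩ := exists_pow_eq_one_of_mem G hk
  have h1 : ((g⁻¹ * h : Matrix.specialUnitaryGroup (Fin 2) ℂ) : Matrix (Fin 2) (Fin 2) ℂ) *ᵥ v
      = v := by
    have h2 : ((g⁻¹ : Matrix.specialUnitaryGroup (Fin 2) ℂ) : Matrix (Fin 2) (Fin 2) ℂ) *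
        (g : Matrix (Fin 2) (Fin 2) ℂ) = 1 := by
      have := congrArg (fun x : Matrix.specialUnitaryGroup (Fin 2) ℂ =>
        (x : Matrix (Fin 2) (Fin 2) ℂ)) (inv_mul_cancel g)
      exact this
    change (((g⁻¹ : Matrix.specialUnitaryGroup (Fin 2) ℂ) : Matrix (Fin 2) (Fin 2) ℂ) *
        (h : Matrix (Fin 2) (Fin 2) ℂ)) *ᵥ v = v
    rw [← mulVec_mulVec, ← heq, mulVec_mulVec, h2, one_mulVec]
  have h3 := eq_one_of_mulVec_eq_self (det_specialUnitary _) hn hpow hv h1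
  have h4 : g⁻¹ * h = 1 := Subtype.ext h3
  exact (inv_mul_eq_one.1 h4)

/-- The permutation of `G` induced by conjugation with a normalizing matrix. -/
theorem exists_conj_equiv [Finite G] {J K : Matrix (Fin 2) (Fin 2) ℂ} (hKJ : K * J = 1)
    (hnorm : ∀ g ∈ G, ∃ h ∈ G, J * (g : Matrix (Fin 2) (Fin 2) ℂ) * K =
      (h : Matrix (Fin 2) (Fin 2) ℂ)) :
    ∃ τ : G ≃ G, ∀ g : G, J * ((g : Matrix.specialUnitaryGroup (Fin 2) ℂ) :
      Matrix (Fin 2) (Fin 2) ℂ) = ((τ g : Matrix.specialUnitaryGroup (Fin 2) ℂ) :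
      Matrix (Fin 2) (Fin 2) ℂ) * J := by
  choose τ hτ using fun g : G => hnorm g g.2
  have hJK : J * K = 1 := mul_eq_one_comm.1 hKJ
  have hinj : Function.Injective fun g : G => (⟨τ g, (hτ g).1⟩ : G) := by
    intro g h hgh
    have h1 : τ g = τ h := congrArg Subtype.val hgh
    have h2 := (hτ g).2.trans ((congrArg Subtype.val h1).trans (hτ h).2.symm)
    have h3 := congrArg (fun X => K * X * J) h2
    simp only [mul_assoc, hKJ, mul_one] at h3
    simp only [← mul_assoc, hKJ, one_mul] at h3
    exact Subtype.ext (Subtype.ext h3)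
  refine ⟨Equiv.ofBijective _ (Finite.injective_iff_bijective.1 hinj), fun g => ?_⟩
  change _ = ((τ g : Matrix.specialUnitaryGroup (Fin 2) ℂ) : Matrix (Fin 2) (Fin 2) ℂ) * J
  rw [← (hτ g).2, mul_assoc, hKJ, mul_one]

/-- A matrix normalizing a nontrivial finite subgroup of `SU(2)` of order other than two is
diagonalizable. -/
theorem isDiagonalizable_of_normalizes [Finite G] (hG : G ≠ ⊥) {J K : Matrix (Fin 2) (Fin 2) ℂ}
    (hKJ : K * J = 1)
    (hnorm : ∀ g ∈ G, ∃ h ∈ G, J * (g : Matrix (Fin 2) (Fin 2) ℂ) * K =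
      (h : Matrix (Fin 2) (Fin 2) ℂ)) (hcard : Nat.card G ≠ 2) : IsDiagonalizableMatrix J := by
  by_contra hJ
  obtain ⟨a, hN0, hN⟩ := exists_nilpotent_of_not_diagonalizable hJ
  obtain ⟨τ, hτ⟩ := exists_conj_equiv G hKJ hnorm
  set N := J - a • (1 : Matrix (Fin 2) (Fin 2) ℂ) with hNdef
  have hJN : J = a • 1 + N := by rw [hNdef]; abel
  have ha : a ≠ 0 := by
    intro h0
    rw [h0, zero_smul, zero_add] at hJN
    rw [← hJN] at hN hN0
    apply hN0
    calc J = (K * J) * J := by rw [hKJ, one_mul]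
      _ = K * (J * J) := mul_assoc _ _ _
      _ = 0 := by rw [hN, mul_zero]
  have hpow : ∀ (m : ℕ) (g : G), J ^ m * ((g : Matrix.specialUnitaryGroup (Fin 2) ℂ) :
      Matrix (Fin 2) (Fin 2) ℂ) = (((τ ^ m : Equiv.Perm G) g : Matrix.specialUnitaryGroup (Fin 2) ℂ) :
      Matrix (Fin 2) (Fin 2) ℂ) * J ^ m := by
    intro m
    induction m with
    | zero => intro g; simp
    | succ m ih =>
      intro g
      rw [pow_succ J, mul_assoc, hτ, ← mul_assoc, ih, mul_assoc, ← pow_succ, pow_succ τ,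
        Equiv.Perm.mul_apply]
  have hJpow := pow_succ_of_sub_smul_sq_eq_zero hN
  -- With `m + 1` the order of `τ`, the power `J ^ (m + 1)` commutes with `G`. Its nilpotent part is
  -- `(m + 1) * a ^ m * N`, a nonzero multiple of `N`.
  obtain ⟨m, hm⟩ : ∃ m, orderOf (τ : Equiv.Perm G) = m + 1 :=
    Nat.exists_eq_succ_of_ne_zero (orderOf_pos (τ : Equiv.Perm G)).ne'
  have hτ1 : (τ : Equiv.Perm G) ^ (m + 1) = 1 := by rw [← hm, pow_orderOf_eq_one]
  have hcomm : ∀ g : G, N * ((g : Matrix.specialUnitaryGroup (Fin 2) ℂ) :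
      Matrix (Fin 2) (Fin 2) ℂ) = ((g : Matrix.specialUnitaryGroup (Fin 2) ℂ) :
      Matrix (Fin 2) (Fin 2) ℂ) * N := by
    intro g
    have h1 := hpow (m + 1) g
    rw [hτ1, Equiv.Perm.one_apply, hJpow, ← hNdef] at h1
    simp only [add_mul, mul_add, smul_mul_assoc, mul_smul_comm, one_mul, mul_one,
      add_right_inj] at h1
    have h2 : ((m + 1 : ℕ) : ℂ) * a ^ m ≠ 0 :=
      mul_ne_zero (by exact_mod_cast Nat.succ_ne_zero m) (pow_ne_zero _ ha)
    exact smul_right_injective _ h2 h1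
  have hscalar : ∀ g ∈ G, (g : Matrix (Fin 2) (Fin 2) ℂ) = 1 ∨
      (g : Matrix (Fin 2) (Fin 2) ℂ) = -1 := by
    intro g hg
    obtain ⟨n, hn, hgn⟩ := exists_pow_eq_one_of_mem G hg
    have h1 := sub_smul_one_eq_zero_of_pow_eq_one
      (sq_eq_zero_of_commute_nilpotent hN0 hN (hcomm ⟨g, hg⟩)) hn hgn
    have h2 := sub_eq_zero.1 h1
    have h3 := det_specialUnitary g
    generalize ((g : Matrix (Fin 2) (Fin 2) ℂ) 0 0 + (g : Matrix (Fin 2) (Fin 2) ℂ) 1 1) / 2 = t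
      at h2
    rw [h2, det_smul, det_one, mul_one, Fintype.card_fin] at h3
    rcases (sq_eq_sq_iff_eq_or_eq_neg.1 (h3.trans (one_pow 2).symm)) with h | h
    · left; rw [h2, h, one_smul]
    · right; rw [h2, h, neg_one_smul]
  obtain ⟨g, hg, hg1⟩ := G.ne_bot_iff_exists_ne_one.1 hG |>.elim fun x hx =>
    (⟨x.1, x.2, fun h => hx (Subtype.ext h)⟩ : ∃ g, g ∈ G ∧ g ≠ 1)
  have hgm : (g : Matrix (Fin 2) (Fin 2) ℂ) = -1 :=
    (hscalar g hg).resolve_left fun h => hg1 (Subtype.ext h)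
  refine hcard (Nat.card_eq_two_iff.2 ⟨1, ⟨g, hg⟩, fun h => hg1 (congrArg Subtype.val h).symm, ?_⟩)
  ext x
  simp only [Set.mem_insert_iff, Set.mem_singleton_iff, Set.mem_univ, iff_true]
  rcases hscalar x x.2 with h | h
  · exact Or.inl (Subtype.ext (Subtype.ext h))
  · exact Or.inr (Subtype.ext (Subtype.ext (h.trans hgm.symm)))

end FiniteSubgroup


/-! ### Local biholomorphisms and their Jacobian matrices -/

/-- The continuous linear map of multiplication by a matrix. -/
noncomputable def mulVecCLM (A : Matrix (Fin 2) (Fin 2) ℂ) : (Fin 2 → ℂ) →L[ℂ] (Fin 2 → ℂ) :=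
  LinearMap.toContinuousLinearMap (Matrix.toLin' A)

theorem mulVecCLM_apply (A : Matrix (Fin 2) (Fin 2) ℂ) (v : Fin 2 → ℂ) :
    mulVecCLM A v = A *ᵥ v := rfl

theorem mulVecCLM_mul (A B : Matrix (Fin 2) (Fin 2) ℂ) :
    mulVecCLM (A * B) = mulVecCLM A ∘L mulVecCLM B := by
  ext1 v
  exact (mulVec_mulVec v A B).symm

theorem mulVecCLM_one : mulVecCLM 1 = ContinuousLinearMap.id ℂ (Fin 2 → ℂ) := by
  ext1 v
  simp [mulVecCLM_apply]

theorem mulVecCLM_injective : Function.Injective mulVecCLM := fun _ _ h =>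
  Matrix.toLin'.injective (LinearMap.ext fun v => congrArg (fun T => T v) h)

/-- The continuous linear equivalence of multiplication by an invertible matrix. -/
noncomputable def mulVecCLE {J K : Matrix (Fin 2) (Fin 2) ℂ} (h : K * J = 1) :
    (Fin 2 → ℂ) ≃L[ℂ] (Fin 2 → ℂ) :=
  ContinuousLinearEquiv.equivOfInverse (mulVecCLM J) (mulVecCLM K)
    (fun v => by rw [mulVecCLM_apply, mulVecCLM_apply, mulVec_mulVec, h, one_mulVec])
    (fun v => by
      rw [mulVecCLM_apply, mulVecCLM_apply, mulVec_mulVec, mul_eq_one_comm.1 h, one_mulVec])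

theorem mulVecCLE_apply {J K : Matrix (Fin 2) (Fin 2) ℂ} (h : K * J = 1) (v : Fin 2 → ℂ) :
    mulVecCLE h v = J *ᵥ v := rfl

theorem mulVecCLE_symm_apply {J K : Matrix (Fin 2) (Fin 2) ℂ} (h : K * J = 1) (v : Fin 2 → ℂ) :
    (mulVecCLE h).symm v = K *ᵥ v := rfl

theorem mulVecCLM_jacobianAtZero (f : (Fin 2 → ℂ) → (Fin 2 → ℂ)) :
    mulVecCLM (jacobianAtZero f) = fderiv ℂ f 0 := by
  ext1 v
  simp [mulVecCLM, jacobianAtZero]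

theorem HasFDerivAt.jacobianAtZero_eq {f : (Fin 2 → ℂ) → (Fin 2 → ℂ)}
    {A : Matrix (Fin 2) (Fin 2) ℂ} (h : HasFDerivAt f (mulVecCLM A) 0) : jacobianAtZero f = A :=
  mulVecCLM_injective (by rw [mulVecCLM_jacobianAtZero, h.fderiv])

namespace IsLocalBiholomorphism

variable {F : OpenPartialHomeomorph (Fin 2 → ℂ) (Fin 2 → ℂ)}

theorem symm (hF : IsLocalBiholomorphism F) : IsLocalBiholomorphism F.symm where
  zero_mem_source := by
    rw [F.symm_source]
    simpa only [hF.map_zero] using F.map_source hF.zero_mem_source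
  map_zero := by
    have := F.left_inv hF.zero_mem_source
    rwa [hF.map_zero] at this
  analytic := hF.analytic_symm
  analytic_symm := by simpa using hF.analytic

theorem analyticAt_zero (hF : IsLocalBiholomorphism F) : AnalyticAt ℂ F 0 :=
  hF.analytic 0 hF.zero_mem_source

theorem hasFDerivAt (hF : IsLocalBiholomorphism F) :
    HasFDerivAt F (mulVecCLM (jacobianAtZero F)) 0 := by
  rw [mulVecCLM_jacobianAtZero]
  exact hF.analyticAt_zero.differentiableAt.hasFDerivAt

theorem eventually_left_inv (hF : IsLocalBiholomorphism F) : ∀ᶠ z in 𝓝 0, F.symm (F z) = z := by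
  filter_upwards [F.open_source.mem_nhds hF.zero_mem_source] with z hz using F.left_inv hz

theorem tendsto_zero (hF : IsLocalBiholomorphism F) : Tendsto F (𝓝 0) (𝓝 0) := by
  simpa only [hF.map_zero] using hF.analyticAt_zero.continuousAt.tendsto

theorem jacobianAtZero_symm_mul (hF : IsLocalBiholomorphism F) :
    jacobianAtZero F.symm * jacobianAtZero F = 1 := by
  apply mulVecCLM_injective
  rw [mulVecCLM_mul, mulVecCLM_one]
  have h1 : HasFDerivAt F.symm (mulVecCLM (jacobianAtZero F.symm)) (F 0) := by
    rw [hF.map_zero]; exact hF.symm.hasFDerivAt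
  have h2 := h1.comp 0 hF.hasFDerivAt
  exact h2.unique ((hasFDerivAt_id (0 : Fin 2 → ℂ)).congr_of_eventuallyEq hF.eventually_left_inv)

theorem hasFDerivAt_conj (hF : IsLocalBiholomorphism F) (A : Matrix (Fin 2) (Fin 2) ℂ) :
    HasFDerivAt (fun z => F (A *ᵥ F.symm z))
      (mulVecCLM (jacobianAtZero F * A * jacobianAtZero F.symm)) 0 := by
  rw [mulVecCLM_mul, mulVecCLM_mul]
  have h0 : A *ᵥ F.symm 0 = 0 := by rw [hF.symm.map_zero, mulVec_zero]
  have h1 : HasFDerivAt F (mulVecCLM (jacobianAtZero F)) (mulVecCLM A (F.symm 0)) := by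
    rw [mulVecCLM_apply, h0]; exact hF.hasFDerivAt
  exact (h1.comp _ (mulVecCLM A).hasFDerivAt).comp 0 hF.symm.hasFDerivAt

end IsLocalBiholomorphism

/-! ### Germs moving points within their orbits -/

section Orbit

variable {G : Subgroup (Matrix.specialUnitaryGroup (Fin 2) ℂ)} [Finite G]
  {φ : (Fin 2 → ℂ) → (Fin 2 → ℂ)}

/-- If a germ maps each point into its `G`-orbit, then its derivative belongs to `G`. -/
theorem exists_mem_eq_of_eventually_mem_orbit {M : Matrix (Fin 2) (Fin 2) ℂ}
    (hφ : HasFDerivAt φ (mulVecCLM M) 0) (hφ0 : φ 0 = 0)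
    (horbit : ∀ᶠ z in 𝓝 0, ∃ h ∈ G, φ z = (h : Matrix (Fin 2) (Fin 2) ℂ) *ᵥ z) :
    ∃ h ∈ G, M = (h : Matrix (Fin 2) (Fin 2) ℂ) := by
  -- Along the line through `v`, the difference quotients take values in the finite set `G v`. By
  -- pigeonhole one value recurs, and it equals the limit `M v`.
  have hpoint : ∀ v : Fin 2 → ℂ, ∃ h : G, M *ᵥ v =
      ((h : Matrix.specialUnitaryGroup (Fin 2) ℂ) : Matrix (Fin 2) (Fin 2) ℂ) *ᵥ v := by
    intro v
    have hline : HasDerivAt (fun t : ℂ => φ (t • v)) (M *ᵥ v) 0 := by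
      have h1 : HasDerivAt (fun t : ℂ => t • v) v 0 := by
        simpa using (hasDerivAt_id (0 : ℂ)).smul_const v
      have h2 : HasFDerivAt φ (mulVecCLM M) ((0 : ℂ) • v) := by rwa [zero_smul]
      exact h2.comp_hasDerivAt 0 h1
    have hslope := hline.tendsto_slope_zero
    have htend : Tendsto (fun t : ℂ => t • v) (𝓝[≠] 0) (𝓝 0) := by
      have : Continuous fun t : ℂ => t • v := by fun_prop
      have h := this.tendsto 0
      rw [zero_smul] at h
      exact h.mono_left nhdsWithin_le_nhds
    have hfreq : ∃ᶠ t : ℂ in 𝓝[≠] 0, ∃ h : G, t⁻¹ • (φ ((0 + t) • v) - φ ((0 : ℂ) • v)) =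
        ((h : Matrix.specialUnitaryGroup (Fin 2) ℂ) : Matrix (Fin 2) (Fin 2) ℂ) *ᵥ v := by
      apply Eventually.frequently
      filter_upwards [htend.eventually horbit, self_mem_nhdsWithin] with t ⟨h, hh, ht⟩ ht0
      refine ⟨⟨h, hh⟩, ?_⟩
      rw [zero_add, zero_smul, hφ0, sub_zero, ht, mulVec_smul, smul_smul,
        inv_mul_cancel₀ ht0, one_smul]
    obtain ⟨h, hh⟩ := frequently_exists.1 hfreq
    exact ⟨h, (isClosed_singleton.mem_of_frequently_of_tendsto hh hslope)⟩
  -- Over an infinite field a space is not a finite union of proper subspaces, so one `h` works for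
  -- all `v`.
  obtain ⟨h, hh⟩ := Subspace.exists_eq_top_of_iUnion_eq_univ
    (p := fun h : G => LinearMap.ker (Matrix.toLin' (M -
      ((h : Matrix.specialUnitaryGroup (Fin 2) ℂ) : Matrix (Fin 2) (Fin 2) ℂ)))) (by
    rw [Set.eq_univ_iff_forall]
    intro v
    obtain ⟨h, hv⟩ := hpoint v
    refine Set.mem_iUnion.2 ⟨h, ?_⟩
    simp only [SetLike.mem_coe, LinearMap.mem_ker, toLin'_apply, sub_mulVec, hv, sub_self])
  refine ⟨h, h.2, sub_eq_zero.1 ?_⟩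
  rw [LinearMap.ker_eq_top] at hh
  exact Matrix.toLin'.map_eq_zero_iff.1 hh

/-- A germ that maps each point into its `G`-orbit coincides with its derivative. -/
theorem eventually_eq_mulVec_of_eventually_mem_orbit {g : Matrix.specialUnitaryGroup (Fin 2) ℂ}
    (hg : g ∈ G) (hφ : HasFDerivAt φ (mulVecCLM (g : Matrix (Fin 2) (Fin 2) ℂ)) 0) (hφ0 : φ 0 = 0)
    (horbit : ∀ᶠ z in 𝓝 0, ∃ h ∈ G, φ z = (h : Matrix (Fin 2) (Fin 2) ℂ) *ᵥ z) :
    ∀ᶠ z in 𝓝 0, φ z = (g : Matrix (Fin 2) (Fin 2) ℂ) *ᵥ z := by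
  -- Freeness of the action makes `h - g` injective, hence bounded below. As `φ - g` is `o(‖z‖)`,
  -- this excludes `φ z = h z` for small `z ≠ 0`.
  have hlower : ∀ h : G, (h : Matrix.specialUnitaryGroup (Fin 2) ℂ) ≠ g → ∃ c : ℝ, 0 < c ∧
      ∀ z : Fin 2 → ℂ, c * ‖z‖ ≤ ‖((h : Matrix.specialUnitaryGroup (Fin 2) ℂ) :
        Matrix (Fin 2) (Fin 2) ℂ) *ᵥ z - (g : Matrix (Fin 2) (Fin 2) ℂ) *ᵥ z‖ := by
    intro h hne
    obtain ⟨K, hK, hanti⟩ := LinearMap.exists_antilipschitzWith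
      (Matrix.toLin' (((h : Matrix.specialUnitaryGroup (Fin 2) ℂ) : Matrix (Fin 2) (Fin 2) ℂ) -
        (g : Matrix (Fin 2) (Fin 2) ℂ))) (by
      rw [LinearMap.ker_eq_bot']
      intro z hz
      by_contra hz0
      rw [toLin'_apply, sub_mulVec, sub_eq_zero] at hz
      exact hne (eq_of_mulVec_eq G h.2 hg hz0 hz))
    refine ⟨(K : ℝ)⁻¹, inv_pos.2 hK, fun z => ?_⟩
    have h1 := hanti.le_mul_dist z 0
    rw [map_zero, dist_zero_right, dist_zero_right, toLin'_apply, sub_mulVec] at h1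
    rwa [inv_mul_le_iff₀ (show (0 : ℝ) < K from hK)]
  have hexcl : ∀ h : G, (h : Matrix.specialUnitaryGroup (Fin 2) ℂ) ≠ g → ∀ᶠ z in 𝓝 0,
      φ z = ((h : Matrix.specialUnitaryGroup (Fin 2) ℂ) : Matrix (Fin 2) (Fin 2) ℂ) *ᵥ z →
        z = 0 := by
    intro h hne
    obtain ⟨c, hc, hcz⟩ := hlower h hne
    have hlittle := hφ.isLittleO.def (half_pos hc)
    filter_upwards [hlittle] with z hz hφz
    rw [hφ0, sub_zero, sub_zero, mulVecCLM_apply, hφz] at hz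
    have h1 := (hcz z).trans hz
    have h2 : ‖z‖ ≤ 0 := by nlinarith [norm_nonneg z]
    exact norm_le_zero_iff.1 h2
  have hall : ∀ᶠ z in 𝓝 0, ∀ h : G, (h : Matrix.specialUnitaryGroup (Fin 2) ℂ) ≠ g →
      φ z = ((h : Matrix.specialUnitaryGroup (Fin 2) ℂ) : Matrix (Fin 2) (Fin 2) ℂ) *ᵥ z →
        z = 0 := by
    rw [eventually_all]
    intro h
    by_cases hne : (h : Matrix.specialUnitaryGroup (Fin 2) ℂ) = g
    · exact Eventually.of_forall fun z hh => absurd hne hh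
    · exact (hexcl h hne).mono fun z hz _ => hz
  filter_upwards [horbit, hall] with z ⟨h, hh, hz⟩ hzall
  by_cases hne : h = g
  · rw [hz, hne]
  · rw [hzall ⟨h, hh⟩ hne hz, hφ0, mulVec_zero]

end Orbit

/-! ### Inverse germs, averaging and the main theorem -/

/-- The inverse function theorem for local biholomorphisms. -/
theorem exists_isLocalBiholomorphism_coe_eq {H : (Fin 2 → ℂ) → (Fin 2 → ℂ)}
    (hH : AnalyticAt ℂ H 0) (hH0 : H 0 = 0) {L : (Fin 2 → ℂ) ≃L[ℂ] (Fin 2 → ℂ)}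
    (hH1 : HasFDerivAt H (L : (Fin 2 → ℂ) →L[ℂ] (Fin 2 → ℂ)) 0) :
    ∃ E : OpenPartialHomeomorph (Fin 2 → ℂ) (Fin 2 → ℂ), IsLocalBiholomorphism E ∧ ⇑E = H := by
  have hstrict : HasStrictFDerivAt H (L : (Fin 2 → ℂ) →L[ℂ] (Fin 2 → ℂ)) 0 := by
    rw [← hH1.fderiv]
    exact hH.hasStrictFDerivAt
  set R := hstrict.toOpenPartialHomeomorph H with hR
  have hRH : ⇑R = H := hstrict.toOpenPartialHomeomorph_coe
  have h0 : (0 : Fin 2 → ℂ) ∈ R.source := hstrict.mem_toOpenPartialHomeomorph_source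
  have hsymm : AnalyticAt ℂ R.symm 0 := by
    have := R.analyticAt_symm' (i := L) h0 (by rwa [hRH]) (by rw [hRH]; exact hH1.fderiv)
    rwa [hRH, hH0] at this
  set U := {z | AnalyticAt ℂ H z} with hU
  set V := {z | AnalyticAt ℂ R.symm z} with hV
  -- The source is shrunk so that both `H` and its inverse are analytic throughout, not just at `0`.
  have hopen : IsOpen (U ∩ (R.source ∩ R ⁻¹' V)) :=
    (isOpen_analyticAt ℂ H).inter (R.isOpen_inter_preimage (isOpen_analyticAt ℂ R.symm))
  refine ⟨R.restrOpen _ hopen, ⟨?_, ?_, ?_, ?_⟩, hRH⟩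
  · refine ⟨h0, hH, h0, ?_⟩
    change AnalyticAt ℂ R.symm (R 0)
    rwa [hRH, hH0]
  · change R 0 = 0
    rw [hRH, hH0]
  · intro z hz
    change AnalyticAt ℂ R z
    rw [hRH]
    exact hz.2.1
  · intro z hz
    have hz' : R.symm z ∈ (R.restrOpen _ hopen).source := (R.restrOpen _ hopen).map_target hz
    have h2 : AnalyticAt ℂ R.symm (R (R.symm z)) := hz'.2.2.2
    have hzR : z ∈ R.target := hz.1
    rw [R.right_inv hzR] at h2
    exact h2

/-- Two normalized germs intertwining `f` with the same nonresonant linear map, in opposite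
directions, are inverse to each other. -/
theorem eventually_comp_eq_self_of_intertwine {f A H : (Fin 2 → ℂ) → (Fin 2 → ℂ)} {d : Fin 2 → ℂ}
    {P L : (Fin 2 → ℂ) ≃L[ℂ] (Fin 2 → ℂ)} (hL : ∀ v j, P.symm (L (P v)) j = d j * v j)
    (hd : ∀ k : Fin 2 → ℕ, 2 ≤ expDegree k → ∀ j, ∏ i, d i ^ k i ≠ d j)
    (hA : AnalyticAt ℂ A 0) (hA0 : A 0 = 0)
    (hA1 : HasFDerivAt A (ContinuousLinearMap.id ℂ (Fin 2 → ℂ)) 0)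
    (hAf : ∀ᶠ z in 𝓝 0, A (f z) = L (A z))
    (hH : AnalyticAt ℂ H 0) (hH0 : H 0 = 0)
    (hH1 : HasFDerivAt H (ContinuousLinearMap.id ℂ (Fin 2 → ℂ)) 0)
    (hHf : ∀ᶠ z in 𝓝 0, f (H z) = H (L z)) : ∀ᶠ z in 𝓝 0, A (H z) = z := by
  have hAH : AnalyticAt ℂ (fun z => A (H z)) 0 := AnalyticAt.comp (by rwa [hH0]) hH
  have hAH1 : HasFDerivAt (fun z => A (H z)) (ContinuousLinearMap.id ℂ (Fin 2 → ℂ)) 0 := by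
    have h1 : HasFDerivAt A (ContinuousLinearMap.id ℂ (Fin 2 → ℂ)) (H 0) := by rwa [hH0]
    exact h1.comp 0 hH1
  have hHt : Tendsto H (𝓝 0) (𝓝 0) := by simpa only [hH0] using hH.continuousAt.tendsto
  have hzero := eventually_eq_zero_of_commute_conj (g := fun z => A (H z) - z)
    (hAH.sub analyticAt_id) (by simp only [hH0, hA0, sub_zero])
    (by simpa using! hAH1.sub (hasFDerivAt_id (0 : Fin 2 → ℂ))) hL hd (by
      filter_upwards [hHf, hHt.eventually hAf] with z h1 h2
      rw [← h1, h2, map_sub])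
  filter_upwards [hzero] with z hz using sub_eq_zero.1 hz

/-- The average of the conjugates of a linearization over a finite group normalized by the linear
part is a linearization. -/
theorem eventually_average_linearizes {Γ E : Type*} [Group Γ] [Fintype Γ] [NormedAddCommGroup E]
    [NormedSpace ℂ E] (ρ : Γ →* (E →L[ℂ] E)) (τ : Γ ≃ Γ) {J : E →L[ℂ] E} {f A : E → E}
    (hJ : ∀ g z, J (ρ g z) = ρ (τ g) (J z))
    (hf : ∀ g, ∀ᶠ z in 𝓝 0, f (ρ g z) = ρ (τ g) (f z))
    (hA : ∀ᶠ z in 𝓝 0, A (f z) = J (A z)) :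
    ∀ᶠ z in 𝓝 0, ∑ g, ρ g⁻¹ (A (ρ g (f z))) = J (∑ g, ρ g⁻¹ (A (ρ g z))) := by
  have hinv : ∀ g z, ρ (τ g)⁻¹ (J z) = J (ρ g⁻¹ z) := by
    intro g z
    have hid : ∀ (x : Γ) w, ρ x⁻¹ (ρ x w) = w := fun x w => by
      rw [← mul_apply_eq_comp, ← map_mul, inv_mul_cancel, map_one,
        one_apply_eq_self]
    have h1 := hJ g (ρ g⁻¹ z)
    have h2 : ρ g (ρ g⁻¹ z) = z := by simpa using hid g⁻¹ z
    rw [h2] at h1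
    rw [h1, hid]
  have ht : ∀ g, Tendsto (ρ g) (𝓝 0) (𝓝 0) := fun g => by
    simpa using (ρ g).continuous.tendsto 0
  filter_upwards [eventually_all.2 hf, eventually_all.2 fun g => (ht g).eventually hA] with z h1 h2
  -- After reindexing by `τ`, the summands match one by one, since `f ∘ g = τ g ∘ f` and `(τ g)⁻¹ J
  -- = J g⁻¹`.
  rw [← Equiv.sum_comp τ, map_sum]
  refine Finset.sum_congr rfl fun g _ => ?_
  rw [← h1, h2, hinv]

/-- The standard representation of a subgroup of `SU(2)`. -/
noncomputable def standardRep (G : Subgroup (Matrix.specialUnitaryGroup (Fin 2) ℂ)) :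
    G →* ((Fin 2 → ℂ) →L[ℂ] (Fin 2 → ℂ)) where
  toFun g := mulVecCLM ((g : Matrix.specialUnitaryGroup (Fin 2) ℂ) : Matrix (Fin 2) (Fin 2) ℂ)
  map_one' := mulVecCLM_one
  map_mul' _ _ := mulVecCLM_mul _ _

/-- A diagonalizable matrix in the form used by `exists_linearization_of_conj`. -/
theorem IsDiagonalizableMatrix.exists_conj {J K : Matrix (Fin 2) (Fin 2) ℂ} (hKJ : K * J = 1)
    (h : IsDiagonalizableMatrix J) {α₁ α₂ : ℂ} (hroots : J.charpoly.roots = {α₁, α₂})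
    (hdio : IsDiophantinePair α₁ α₂) :
    ∃ (d : Fin 2 → ℂ) (P : (Fin 2 → ℂ) ≃L[ℂ] (Fin 2 → ℂ)), (∀ j, d j ≠ 0) ∧
      IsDiophantinePair (d 0) (d 1) ∧ ∀ v j, P.symm (mulVecCLE hKJ (P v)) j = d j * v j := by
  obtain ⟨P, d, hPd⟩ := h
  have hPinv : ((P⁻¹ : GL (Fin 2) ℂ) : Matrix (Fin 2) (Fin 2) ℂ) * (P : Matrix (Fin 2) (Fin 2) ℂ)
      = 1 := Units.inv_mul P
  have hconj : ((P⁻¹ : GL (Fin 2) ℂ) : Matrix (Fin 2) (Fin 2) ℂ) *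
      (J * (P : Matrix (Fin 2) (Fin 2) ℂ)) = diagonal d := by
    rw [hPd, mul_assoc, mul_assoc, hPinv, mul_one, ← mul_assoc, hPinv, one_mul]
  have hdet : J.det ≠ 0 := by
    intro h0
    have := congrArg Matrix.det hKJ
    rw [det_mul, h0, mul_zero, det_one] at this
    exact zero_ne_one this
  have hdetd : d 0 * d 1 ≠ 0 := by
    have := congrArg Matrix.det hPd
    rw [det_mul, det_mul, det_diagonal, Fin.prod_univ_two, mul_comm (Matrix.det _), mul_assoc,
      ← det_mul, Units.mul_inv, det_one, mul_one] at this
    rwa [← this]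
  refine ⟨d, mulVecCLE hPinv, ?_, ?_, ?_⟩
  · intro j
    fin_cases j
    exacts [left_ne_zero_of_mul hdetd, right_ne_zero_of_mul hdetd]
  · have hchar : J.charpoly = (Polynomial.X - Polynomial.C (d 0)) *
        (Polynomial.X - Polynomial.C (d 1)) := by
      rw [hPd, Matrix.charpoly_mul_comm, ← mul_assoc, hPinv, one_mul, charpoly_diagonal,
        Fin.prod_univ_two]
    have hne : (Polynomial.X - Polynomial.C (d 0)) * (Polynomial.X - Polynomial.C (d 1)) ≠ 0 :=
      mul_ne_zero (Polynomial.X_sub_C_ne_zero _) (Polynomial.X_sub_C_ne_zero _)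
    rw [hchar, Polynomial.roots_mul hne, Polynomial.roots_X_sub_C, Polynomial.roots_X_sub_C,
      Multiset.singleton_add] at hroots
    -- The eigenvalues are known only up to order, and the Diophantine condition is symmetric.
    rcases Multiset.cons_eq_cons.1 hroots with ⟨h0, h1⟩ | ⟨-, c, h1, h2⟩
    · rw [h0, Multiset.singleton_inj.1 h1]
      exact hdio
    · have hc : c = 0 := by
        have := congrArg Multiset.card h1
        simpa using this
      rw [hc] at h1 h2
      rw [Multiset.singleton_inj.1 h1, ← Multiset.singleton_inj.1 h2]
      obtain ⟨K, c, hK, hc, hKc⟩ := hdio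
      refine ⟨K, c, hK, hc, fun n₁ n₂ hn => ?_⟩
      have := hKc n₂ n₁ (by omega)
      rw [add_comm (n₂ : ℝ), mul_comm (α₁ ^ n₂)] at this
      exact ⟨this.2, this.1⟩
  · intro v j
    rw [mulVecCLE_symm_apply, mulVecCLE_apply, mulVecCLE_apply, mulVec_mulVec, mulVec_mulVec, mul_assoc,
      hconj, mulVec_diagonal]

theorem theorem2p4 (G : Subgroup (Matrix.specialUnitaryGroup (Fin 2) ℂ)) [Finite G]
    (hG : G ≠ ⊥) (F : OpenPartialHomeomorph (Fin 2 → ℂ) (Fin 2 → ℂ))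
    (hF : IsLocalBiholomorphism F) (hFG : IsGEquivariant G F) :
    -- `J = F'(0)` is invertible and normalizes `G`
    IsUnit (jacobianAtZero F).det ∧
    (∀ g ∈ G, ∃ h ∈ G,
      jacobianAtZero F * (g : Matrix (Fin 2) (Fin 2) ℂ) * (jacobianAtZero F)⁻¹ =
        (h : Matrix (Fin 2) (Fin 2) ℂ)) ∧
    -- `J` is diagonalizable unless `G` has order `2`
    (Nat.card G ≠ 2 → IsDiagonalizableMatrix (jacobianAtZero F)) ∧
    -- existence, uniqueness (as a germ at `0`) and `G`-equivariance of the linearization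
    ((Nat.card G = 2 → IsDiagonalizableMatrix (jacobianAtZero F)) →
      ∀ α₁ α₂ : ℂ, (jacobianAtZero F).charpoly.roots = {α₁, α₂} → IsDiophantinePair α₁ α₂ →
        ∃ Φ : OpenPartialHomeomorph (Fin 2 → ℂ) (Fin 2 → ℂ),
          IsLocalBiholomorphism Φ ∧ IsNormalizedLinearization F Φ ∧
          (∀ Ψ : OpenPartialHomeomorph (Fin 2 → ℂ) (Fin 2 → ℂ),
            IsLocalBiholomorphism Ψ → IsNormalizedLinearization F Ψ →
              ∀ᶠ z in 𝓝 (0 : Fin 2 → ℂ), Ψ z = Φ z) ∧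
          ∀ g ∈ G, ∀ᶠ z in 𝓝 (0 : Fin 2 → ℂ),
            Φ ((g : Matrix (Fin 2) (Fin 2) ℂ) *ᵥ z) =
              (g : Matrix (Fin 2) (Fin 2) ℂ) *ᵥ Φ z) := by
  set J := jacobianAtZero F with hJ
  have hKJ : jacobianAtZero F.symm * J = 1 := hF.jacobianAtZero_symm_mul
  have hJinv : J⁻¹ = jacobianAtZero F.symm := inv_eq_left_inv hKJ
  have hconj0 : ∀ A : Matrix (Fin 2) (Fin 2) ℂ, F (A *ᵥ F.symm 0) = 0 := fun A => by
    rw [hF.symm.map_zero, mulVec_zero, hF.map_zero]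
  have hnorm : ∀ g ∈ G, ∃ h ∈ G, J * (g : Matrix (Fin 2) (Fin 2) ℂ) * jacobianAtZero F.symm =
      (h : Matrix (Fin 2) (Fin 2) ℂ) := fun g hg =>
    exists_mem_eq_of_eventually_mem_orbit (hF.hasFDerivAt_conj _) (hconj0 _) (hFG g hg)
  have hdiag : Nat.card G ≠ 2 → IsDiagonalizableMatrix J :=
    isDiagonalizable_of_normalizes G hG hKJ hnorm
  refine ⟨isUnit_det_of_left_inverse hKJ, by rwa [hJinv], hdiag, fun hdiag2 α₁ α₂ hroots hdio => ?_⟩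
  have hJdiag : IsDiagonalizableMatrix J := by
    by_cases h : Nat.card G = 2
    exacts [hdiag2 h, hdiag h]
  obtain ⟨d, P, hd0, hdiod, hL⟩ := hJdiag.exists_conj hKJ hroots hdio
  set L := mulVecCLE hKJ with hLdef
  obtain ⟨H, hH, hH0, hH1, hHF⟩ := exists_linearization_of_conj hF.analyticAt_zero hF.map_zero hL
    hF.hasFDerivAt hd0 hdiod
  obtain ⟨E, hE, hEH⟩ := exists_isLocalBiholomorphism_coe_eq hH hH0
    (L := ContinuousLinearEquiv.refl ℂ (Fin 2 → ℂ)) hH1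
  -- Uniqueness is stated for analytic germs not assumed invertible, so that it also applies to the
  -- average over `G`.
  have huniq : ∀ A : (Fin 2 → ℂ) → (Fin 2 → ℂ), AnalyticAt ℂ A 0 → A 0 = 0 →
      HasFDerivAt A (ContinuousLinearMap.id ℂ (Fin 2 → ℂ)) 0 →
      (∀ᶠ z in 𝓝 0, A (F z) = L (A z)) → ∀ᶠ z in 𝓝 0, A z = E.symm z := by
    intro A hA hA0 hA1 hAF
    have h1 := eventually_comp_eq_self_of_intertwine hL (hdiod.nonresonant hd0) hA hA0 hA1 hAF
      hH hH0 hH1 hHF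
    filter_upwards [hE.symm.tendsto_zero.eventually h1, hE.symm.eventually_left_inv] with z h2 h3
    rw [E.symm_symm, hEH] at h3
    rwa [h3] at h2
  have hlin : ∀ Ψ : OpenPartialHomeomorph (Fin 2 → ℂ) (Fin 2 → ℂ), IsLocalBiholomorphism Ψ →
      (∀ᶠ z in 𝓝 0, Ψ (F (Ψ.symm z)) = J *ᵥ z) → ∀ᶠ z in 𝓝 0, Ψ (F z) = L (Ψ z) := by
    intro Ψ hΨ h
    filter_upwards [hΨ.tendsto_zero.eventually h, hΨ.eventually_left_inv] with z h1 h2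
    rwa [h2] at h1
  have hΦlin : ∀ᶠ z in 𝓝 0, E.symm (F (E.symm.symm z)) = J *ᵥ z := by
    have ht : Tendsto L (𝓝 0) (𝓝 0) := by simpa using L.continuous.tendsto 0
    filter_upwards [hHF, ht.eventually hE.eventually_left_inv] with z h1 h2
    rw [E.symm_symm, hEH, h1, ← hEH, h2]
    rfl
  have hΦ1 : jacobianAtZero E.symm = 1 := by
    have h1 := hE.jacobianAtZero_symm_mul
    have h2 : jacobianAtZero E = 1 :=
      HasFDerivAt.jacobianAtZero_eq (by rw [hEH, mulVecCLM_one]; exact hH1)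
    rwa [h2, mul_one] at h1
  refine ⟨E.symm, hE.symm, ⟨hΦlin, hΦ1⟩, fun Ψ hΨ hΨF => ?_, ?_⟩
  · refine huniq Ψ hΨ.analyticAt_zero hΨ.map_zero ?_ (hlin Ψ hΨ hΨF.1)
    have := hΨ.hasFDerivAt
    rwa [hΨF.2, mulVecCLM_one] at this
  obtain ⟨τ, hτ⟩ := exists_conj_equiv G hKJ hnorm
  have := Fintype.ofFinite G
  set ρ := standardRep G with hρ
  have hFρ : ∀ g : G, ∀ᶠ z in 𝓝 0, F (ρ g z) = ρ (τ g) (F z) := by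
    intro g
    have h1 : J * ((g : Matrix.specialUnitaryGroup (Fin 2) ℂ) : Matrix (Fin 2) (Fin 2) ℂ) *
        jacobianAtZero F.symm = ((τ g : Matrix.specialUnitaryGroup (Fin 2) ℂ) :
        Matrix (Fin 2) (Fin 2) ℂ) := by
      rw [hτ, mul_assoc, mul_eq_one_comm.1 hKJ, mul_one]
    have h2 := eventually_eq_mulVec_of_eventually_mem_orbit (τ g).2
      (by rw [← h1]; exact hF.hasFDerivAt_conj _) (hconj0 _) (hFG g g.2)
    filter_upwards [hF.tendsto_zero.eventually h2, hF.eventually_left_inv] with z h3 h4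
    rwa [h4] at h3
  set A : (Fin 2 → ℂ) → (Fin 2 → ℂ) := fun z =>
    (Fintype.card G : ℂ)⁻¹ • ∑ g : G, ρ g⁻¹ (E.symm (ρ g z)) with hA
  have hcard : (Fintype.card G : ℂ) ≠ 0 := by exact_mod_cast Fintype.card_ne_zero
  have hρρ : ∀ (g h : G) z, ρ g (ρ h z) = ρ (g * h) z := fun g h z => by
    rw [map_mul]; rfl
  have hΦ : ∀ᶠ z in 𝓝 0, A z = E.symm z := by
    refine huniq A ?_ ?_ ?_ ?_
    · have h0 : AnalyticAt ℂ (fun z => ∑ g : G, ρ g⁻¹ (E.symm (ρ g z))) 0 := by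
        refine Finset.univ.analyticAt_fun_sum fun g _ => ?_
        have h1 : AnalyticAt ℂ E.symm (ρ g 0) := by rw [map_zero]; exact hE.symm.analyticAt_zero
        exact ((ρ g⁻¹).analyticAt _).comp (h1.comp ((ρ g).analyticAt 0))
      exact AnalyticAt.const_smul (c := (Fintype.card G : ℂ)⁻¹) h0
    · simp [hA, hE.symm.map_zero]
    · have h1 : ∀ g : G, HasFDerivAt (fun z => ρ g⁻¹ (E.symm (ρ g z)))
          (ContinuousLinearMap.id ℂ (Fin 2 → ℂ)) 0 := by
        intro g
        have h2 : HasFDerivAt E.symm (ContinuousLinearMap.id ℂ (Fin 2 → ℂ)) (ρ g 0) := by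
          rw [map_zero, ← mulVecCLM_one, ← hΦ1]
          exact hE.symm.hasFDerivAt
        have h3 := (ρ g⁻¹).hasFDerivAt.comp 0 (h2.comp 0 (ρ g).hasFDerivAt)
        have h4 : ρ g⁻¹ ∘L (ContinuousLinearMap.id ℂ (Fin 2 → ℂ) ∘L ρ g) =
            ContinuousLinearMap.id ℂ (Fin 2 → ℂ) := by
          ext1 v
          change ρ g⁻¹ (ρ g v) = v
          rw [hρρ, inv_mul_cancel, map_one]
          rfl
        rwa [h4] at h3
      have h4 : HasFDerivAt (fun z => ∑ g : G, ρ g⁻¹ (E.symm (ρ g z)))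
          (∑ _g : G, ContinuousLinearMap.id ℂ (Fin 2 → ℂ)) 0 :=
        HasFDerivAt.fun_sum fun g _ => h1 g
      have h5 := h4.const_smul (Fintype.card G : ℂ)⁻¹
      have h6 : (Fintype.card G : ℂ)⁻¹ • ∑ _g : G, ContinuousLinearMap.id ℂ (Fin 2 → ℂ) =
          ContinuousLinearMap.id ℂ (Fin 2 → ℂ) := by
        rw [Finset.sum_const, Finset.card_univ, ← Nat.cast_smul_eq_nsmul ℂ, smul_smul,
          inv_mul_cancel₀ hcard, one_smul]
      rw [h6] at h5
      exact h5
    · have h1 := eventually_average_linearizes ρ τ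
        (J := (L : (Fin 2 → ℂ) →L[ℂ] (Fin 2 → ℂ))) (fun g z => by
          change J *ᵥ (((g : Matrix.specialUnitaryGroup (Fin 2) ℂ) :
            Matrix (Fin 2) (Fin 2) ℂ) *ᵥ z) = ((τ g : Matrix.specialUnitaryGroup (Fin 2) ℂ) :
            Matrix (Fin 2) (Fin 2) ℂ) *ᵥ (J *ᵥ z)
          rw [mulVec_mulVec, mulVec_mulVec, hτ]) hFρ (hlin _ hE.symm hΦlin)
      filter_upwards [h1] with z hz
      simp only [hA, map_smul]
      rw [hz]
      rfl
  intro g hg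
  have ht : Tendsto (ρ ⟨g, hg⟩) (𝓝 0) (𝓝 0) := by
    simpa using (ρ ⟨g, hg⟩).continuous.tendsto 0
  filter_upwards [hΦ, ht.eventually hΦ] with z h1 h2
  change E.symm (ρ ⟨g, hg⟩ z) = ρ ⟨g, hg⟩ (E.symm z)
  rw [← h1, ← h2]
  simp only [hA, map_smul, map_sum, hρρ]
  congr 1
  -- The substitution of `h * g⁻¹` for `h` moves `g` from inside `E.symm` to the outside.
  rw [← Equiv.sum_comp (Equiv.mulRight (⟨g, hg⟩ : G)⁻¹)]
  refine Finset.sum_congr rfl fun h _ => ?_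
  simp [mul_assoc]
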